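/- For each positive integer $n$ let $I(n)\subseteq\mathbb{R}$ be a union of at most $K$ intervals (of any kind, possibly empty), where $K$ does not depend on $n$. Let $\mathcal{B}=\mathcal{B}_I$ be the set of positive integers consisting of $1$ and all $n\ge 2$ whose prime factorization $n=p_1\cdots p_k$, $p_1\le p_2\le\dots\le p_k$, satisfies $p_j\in I\big(\prod_{1\le i<j}p_i\big)$ for $1\le j\le k$. Write $B(x)=|\mathcal{B}\cap[1,x]|$ and $B(x,y,\alpha)=|\{n\in\mathcal{B}\cap[1,x]:\{\alpha n\}\le y\}|$, where $\{u\}$ is the fractional part of $u$. For an irrational $\alpha$ with continued fraction convergents $a_j/q_j$, the irrationality measure of $\alpha$ is $1+\limsup_{j\to\infty}\frac{\log q_{j+1}}{\log q_j}$. Let $\kappa<1/\sqrt{6}$ and let $\alpha$ be irrational with finite irrationality measure. Then, for all $x\ge x_0(\alpha)$, $$\sup_{0\le y\le 1}|B(x,y,\alpha)-yB(x)|\ll\frac{x}{\exp\big(\kappa\sqrt{\log x\,\log\log x}\big)},$$ where $x_0(\alpha)$ depends only on $\alpha$ and the implied constant depends only on $\kappa$ and $K$. In particular, if $B(x)\gg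 x\exp\big(-\kappa\sqrt{\log x\,\log\log x}\big)$ (as $x\to\infty$) for some $\kappa<1/\sqrt{6}$, then $\mathcal{B}$ is infinite and the sequence $(\alpha n)_{n\in\mathcal{B}}$, with $\mathcal{B}$ enumerated in increasing order, is uniformly distributed modulo $1$; that is, for all $0\le a<b\le 1$, the proportion of the first $N$ terms whose fractional part lies in $[a,b]$ tends to $b-a$ as $N\to\infty$. -/

import Mathlib

open Filter Topology Asymptotics

/-- `S` is a union of at most `K` intervals of real numbers (of any kind: open, closed, half-open,
bounded or not, degenerate or empty). -/
def IsUnionOfIntervals (K : ℕ) (S : Set ℝ) : Prop :=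
  ∃ J : Fin K → Set ℝ, (∀ i, (J i).OrdConnected) ∧ S = ⋃ i, J i

/-- The set `𝓑_I`: it contains `1` and all `n ≥ 2` with prime factorization `n = p₁ ⋯ p_k`,
`p₁ ≤ ⋯ ≤ p_k`, such that `p_j ∈ I (∏_{i < j} p_i)` for all `1 ≤ j ≤ k`.
(`Nat.primeFactorsList n` is the nondecreasing list of the prime factors of `n` with multiplicity;
here its entries are indexed from `0`.) -/
def setB (I : ℕ → Set ℝ) : Set ℕ :=
  {n | 0 < n ∧ ∀ (j : ℕ) (hj : j < n.primeFactorsList.length),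
    ((n.primeFactorsList[j] : ℕ) : ℝ) ∈ I (n.primeFactorsList.take j).prod}

/-- `B(x)`, the number of elements of `𝓑_I` in `[1, x]`. -/
noncomputable def countB (I : ℕ → Set ℝ) (x : ℝ) : ℕ :=
  {n : ℕ | n ∈ setB I ∧ (n : ℝ) ≤ x}.ncard

/-- `B(x, y, α)`, the number of `n ∈ 𝓑_I ∩ [1, x]` with `{α n} ≤ y`. -/
noncomputable def countBFract (I : ℕ → Set ℝ) (α x y : ℝ) : ℕ :=
  {n : ℕ | n ∈ setB I ∧ (n : ℝ) ≤ x ∧ Int.fract (α * n) ≤ y}.ncard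

/-- `sup_{0 ≤ y ≤ 1} |B(x, y, α) - y B(x)|`. -/
noncomputable def discrepancyB (I : ℕ → Set ℝ) (α x : ℝ) : ℝ :=
  ⨆ y : Set.Icc (0 : ℝ) 1, |(countBFract I α x y : ℝ) - y * (countB I x : ℝ)|

/-- The supremum in `discrepancyB` is that of a bounded set. -/
theorem bddAbove_discrepancyB (I : ℕ → Set ℝ) (α x : ℝ) :
    BddAbove (Set.range fun y : Set.Icc (0 : ℝ) 1 =>
      |(countBFract I α x y : ℝ) - y * (countB I x : ℝ)|) := by
  refine ⟨countB I x, ?_⟩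
  rintro _ ⟨⟨y, hy0, hy1⟩, rfl⟩
  have hfin : {n : ℕ | n ∈ setB I ∧ (n : ℝ) ≤ x}.Finite :=
    (Set.finite_Iic ⌊x⌋₊).subset fun n hn => Nat.le_floor hn.2
  have h1 : (countBFract I α x y : ℝ) ≤ countB I x := by
    refine Nat.cast_le.mpr (Set.ncard_le_ncard ?_ hfin)
    exact fun n hn => ⟨hn.1, hn.2.1⟩
  have h2 : (0 : ℝ) ≤ countBFract I α x y := Nat.cast_nonneg _
  have h3 : (0 : ℝ) ≤ countB I x := Nat.cast_nonneg _
  rw [abs_le]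
  constructor <;> nlinarith

/-- The irrationality measure `1 + limsup_j log q_{j+1} / log q_j` of an irrational number `α`,
where `q_j` is the denominator of the `j`-th continued fraction convergent of `α`. -/
noncomputable def irrationalityMeasure (α : ℝ) : EReal :=
  1 + limsup (fun j : ℕ => ((Real.log ((GenContFract.of α).dens (j + 1)) /
    Real.log ((GenContFract.of α).dens j) : ℝ) : EReal)) atTop

/-- The real sequence `a₀, a₁, a₂, …` is uniformly distributed modulo `1`. -/
def UniformlyDistributedModOne (a : ℕ → ℝ) : Prop :=
  ∀ c d : ℝ, 0 ≤ c → c < d → d ≤ 1 →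
    Tendsto (fun N : ℕ => ({n : ℕ | n < N ∧ Int.fract (a n) ∈ Set.Icc c d}.ncard : ℝ) / N)
      atTop (𝓝 (d - c))

/-! Write `L = errorExponent x` and `Z = exp L`. A form of the Erdős–Turán inequality
(`abs_card_filter_fract_sub_le`) reduces the discrepancy to exponential sums of `expi (h α n)` over
the elements of `𝓑_I` up to `x`, for `h` up to about `Z ^ 2`.

The elements with all prime factors below `Z` are few, by Rankin's trick (`eventually_smooth_le`).
Every other element is uniquely `n = m p`, where `p ≥ Z` is the largest prime factor and `m` is
again in `𝓑_I`. For fixed `m`, membership of `m p` only restricts `p` to a union of at most `K`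
intervals (`mul_prime_mem_setB_iff`), and inclusion–exclusion reduces this to single intervals at
the cost of a factor `2 ^ K` (`norm_sum_finsetB_le`).

For `m > Z` the double sum is bilinear with both variables at least `Z`; `bilinear_le` saves `√Z` up
to logarithms, even though the range of `p` depends on `m`. For `m ≤ Z` the sum over primes is
treated for each `m` by Vinogradov's method (`norm_sum_prime_le`): Möbius inversion over divisors of
the product of primes below `Z` handles integers free of such primes, and the composite ones among
them form another bilinear sum. Both cases need rational approximations to `α h m` with denominator
at least `2 Z` and not too large. These exist because finite irrationality measure makes `α`
Diophantine (`exists_diophantine`, `eventually_exists_rat_approx`).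

The bilinear saving is `Z ^ (-1/2) = exp (-L / 2)`, and Rankin's bound gives any exponent below
`1/2`. The numerical choices lead to `exp (-0.42 L)`, enough because `0.42 > 1 / √6`. -/

/-! ### Geometric exponential sums and the distance to the nearest integer. -/

/-- The additive character `t ↦ exp (2 π i t)`. -/
noncomputable def expi (t : ℝ) : ℂ := Complex.exp (Complex.I * ((2 * Real.pi * t : ℝ) : ℂ))

lemma norm_expi (t : ℝ) : ‖expi t‖ = 1 := by
  rw [expi, mul_comm, Complex.norm_exp_ofReal_mul_I]

lemma expi_zero : expi 0 = 1 := by simp [expi]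

lemma expi_add (s t : ℝ) : expi (s + t) = expi s * expi t := by
  rw [expi, expi, expi, ← Complex.exp_add]
  push_cast
  ring_nf

lemma expi_int (n : ℤ) : expi n = 1 := by
  rw [expi, Complex.exp_eq_one_iff]
  exact ⟨n, by push_cast; ring⟩

lemma expi_nat_mul (n : ℕ) (t : ℝ) : expi (n * t) = expi t ^ n := by
  rw [expi, expi, ← Complex.exp_nat_mul]
  push_cast
  ring_nf

lemma conj_expi (t : ℝ) : (starRingEnd ℂ) (expi t) = expi (-t) := by
  rw [expi, expi, ← Complex.exp_conj, map_mul, Complex.conj_I, Complex.conj_ofReal]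
  push_cast
  ring_nf

/-- The distance of a real number to the nearest integer. -/
noncomputable def distInt (t : ℝ) : ℝ := |t - round t|

lemma distInt_nonneg (t : ℝ) : 0 ≤ distInt t := abs_nonneg _

lemma distInt_le (t : ℝ) (z : ℤ) : distInt t ≤ |t - z| := round_le t z

lemma distInt_neg (t : ℝ) : distInt (-t) = distInt t := by
  apply le_antisymm
  · have h := distInt_le (-t) (-round t)
    rwa [show -t - ((-round t : ℤ) : ℝ) = -(t - round t) by push_cast; ring, abs_neg] at h
  · have h := distInt_le t (-round (-t))
    rwa [show t - ((-round (-t) : ℤ) : ℝ) = -(-t - round (-t)) by push_cast; ring, abs_neg] at h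

/-- The chord length is `2 |sin (π u)|` with `|u| ≤ 1/2`, and concavity of the sine gives `sin (π
|u|) ≥ 2 |u|`. -/
lemma four_mul_distInt_le (t : ℝ) : 4 * distInt t ≤ ‖expi t - 1‖ := by
  have h1 : expi t = expi (t - round t) := by
    have h := expi_add (t - round t) (round t)
    rw [expi_int, mul_one, sub_add_cancel] at h
    exact h
  have hu : |t - round t| ≤ 1 / 2 := abs_sub_round t
  rw [h1, expi, Complex.norm_exp_I_mul_ofReal_sub_one, Real.norm_eq_abs, abs_mul, abs_two, distInt]
  set u := t - round t
  have hpi := Real.pi_pos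
  rw [show 2 * Real.pi * u / 2 = Real.pi * u by ring]
  have h2 : |Real.sin (Real.pi * u)| = |Real.sin (Real.pi * |u|)| := by
    rcases abs_choice u with h | h <;> rw [h]
    rw [mul_neg, Real.sin_neg, abs_neg]
  rw [h2]
  have h3 := Real.mul_le_sin (x := Real.pi * |u|) (by positivity) (by nlinarith)
  have h4 : 2 / Real.pi * (Real.pi * |u|) = 2 * |u| := by field_simp
  rw [h4] at h3
  have := h3.trans (le_abs_self _)
  linarith

/-- A substitute for `min M (1 / (2 ‖θ‖))` that is meaningful also when `θ` is an integer. -/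
noncomputable def linKernel (M θ : ℝ) : ℝ := 2 * M / (1 + 2 * M * distInt θ)

lemma linKernel_nonneg {M : ℝ} (hM : 0 ≤ M) (θ : ℝ) : 0 ≤ linKernel M θ := by
  have := distInt_nonneg θ
  unfold linKernel; positivity

lemma linKernel_neg (M θ : ℝ) : linKernel M (-θ) = linKernel M θ := by
  rw [linKernel, linKernel, distInt_neg]

lemma linKernel_le_two_mul {M : ℝ} (hM : 0 ≤ M) (θ : ℝ) : linKernel M θ ≤ 2 * M := by
  have := distInt_nonneg θ
  exact div_le_self (by positivity) (by nlinarith [mul_nonneg hM this])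

lemma linKernel_le_inv {M δ θ : ℝ} (hM : 0 ≤ M) (hδ : 0 < δ) (h : δ ≤ distInt θ) :
    linKernel M θ ≤ 1 / δ := by
  rw [linKernel, div_le_div_iff₀ (by nlinarith [mul_nonneg hM (hδ.le.trans h)]) hδ]
  nlinarith [mul_le_mul_of_nonneg_left h hM]

lemma linKernel_mono {M N : ℝ} (hM : 0 ≤ M) (h : M ≤ N) (θ : ℝ) :
    linKernel M θ ≤ linKernel N θ := by
  have hd := distInt_nonneg θ
  have hN := hM.trans h
  rw [linKernel, linKernel, div_le_div_iff₀ (by positivity) (by positivity)]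
  nlinarith

/-- The kernel merges two bounds for the norm `s` of a sum with `M` terms: the trivial `s ≤ M`, and
`2 s ‖θ‖ ≤ 1` from the geometric series. Multiplying the second by `M` and adding the first gives `s
(1 + 2 M ‖θ‖) ≤ 2 M`. -/
lemma norm_sum_Ico_expi_le (a b : ℕ) (θ : ℝ) :
    ‖∑ n ∈ Finset.Ico a b, expi (n * θ)‖ ≤ linKernel ((b - a : ℕ) : ℝ) θ := by
  rcases le_total b a with hab | hab
  · rw [Finset.Ico_eq_empty (by omega)]
    simpa using linKernel_nonneg (Nat.cast_nonneg _) θ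
  set s := ‖∑ n ∈ Finset.Ico a b, expi (n * θ)‖ with hs
  have h1 : s ≤ ((b - a : ℕ) : ℝ) := by
    refine (norm_sum_le _ _).trans ?_
    simp [norm_expi]
  have h2 : s * ‖expi θ - 1‖ ≤ 2 := by
    rw [hs, ← norm_mul]
    simp_rw [expi_nat_mul]
    rw [geom_sum_Ico_mul _ hab, ← expi_nat_mul, ← expi_nat_mul]
    refine (norm_sub_le _ _).trans ?_
    rw [norm_expi, norm_expi]; norm_num
  have h3 := four_mul_distInt_le θ
  have hd := distInt_nonneg θ
  have hs0 : 0 ≤ s := norm_nonneg _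
  have hM : (0 : ℝ) ≤ ((b - a : ℕ) : ℝ) := Nat.cast_nonneg _
  rw [linKernel, le_div_iff₀ (by positivity)]
  have h4 : s * (4 * distInt θ) ≤ 2 := (mul_le_mul_of_nonneg_left h3 hs0).trans h2
  nlinarith [mul_le_mul_of_nonneg_left h4 hM]

lemma Finset.exists_eq_Ico_of_ordConnected {S : Finset ℕ} (hS : (S : Set ℕ).OrdConnected) :
    ∃ a b, S = Finset.Ico a b := by
  rcases S.eq_empty_or_nonempty with rfl | hne
  · exact ⟨0, 0, by simp⟩
  · refine ⟨S.min' hne, S.max' hne + 1, ?_⟩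
    ext n
    rw [Finset.mem_Ico]
    constructor
    · exact fun h => ⟨S.min'_le _ h, Nat.lt_succ_of_le (S.le_max' _ h)⟩
    · exact fun h => hS.out (S.min'_mem hne) (S.max'_mem hne) ⟨h.1, Nat.lt_succ_iff.mp h.2⟩

lemma norm_sum_expi_le_of_ordConnected {S : Finset ℕ} (hS : (S : Set ℕ).OrdConnected) {M : ℝ}
    (hM : (S.card : ℝ) ≤ M) (θ : ℝ) : ‖∑ n ∈ S, expi (n * θ)‖ ≤ linKernel M θ := by
  obtain ⟨a, b, rfl⟩ := Finset.exists_eq_Ico_of_ordConnected hS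
  rw [Nat.card_Ico] at hM
  exact (norm_sum_Ico_expi_le a b θ).trans (linKernel_mono (Nat.cast_nonneg _) hM θ)

/-! ### The kernel summed along an arithmetic progression. -/

lemma sum_range_one_div_pred (r : ℕ) :
    ∑ s ∈ Finset.range (r + 2), 1 / (((s - 1 : ℕ)) : ℝ) = harmonic r := by
  induction r with
  | zero => simp [Finset.sum_range_succ]
  | succ r ih =>
    rw [show r + 1 + 2 = (r + 2) + 1 by ring, Finset.sum_range_succ, ih, harmonic_succ]
    push_cast
    simp

lemma sum_range_one_div_pred_le {r : ℕ} (hr : 0 < r) :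
    ∑ s ∈ Finset.range r, 1 / (((s - 1 : ℕ)) : ℝ) ≤ 1 + Real.log r := by
  have h1 : (1 : ℝ) ≤ r := by exact_mod_cast hr
  have h0 := Real.log_nonneg h1
  rcases Nat.lt_or_ge r 2 with h | h
  · have : r = 1 := by omega
    subst this
    simp
  · obtain ⟨k, rfl⟩ := Nat.exists_eq_add_of_le' h
    rw [sum_range_one_div_pred]
    refine (harmonic_le_one_add_log k).trans ?_
    rcases Nat.eq_zero_or_pos k with rfl | hk
    · simpa using h0
    · gcongr
      omega

/-- Modulo 1 the point lies between `(s - 1) / r` and `(s + 2) / r`; the two hypotheses on `δ` bound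
its distance to the integers on either side. -/
lemma distInt_ge_of_residue {x e : ℝ} {r s : ℕ} {t : ℤ} (hr : 0 < r) (he1 : -1 ≤ e) (he2 : e ≤ 2)
    (hx : x = (s + e) / r + t) (δ : ℝ) (h1 : δ ≤ (s - 1) / r) (h2 : δ ≤ (r - s - 2) / r) :
    δ ≤ distInt x := by
  have hr' : (0 : ℝ) < r := by exact_mod_cast hr
  rw [distInt]
  set z := round x
  rcases le_or_gt z t with h | h
  · refine h1.trans (le_trans ?_ (le_abs_self _))
    have : (z : ℝ) ≤ t := by exact_mod_cast h
    have h3 : ((s : ℝ) - 1) / r ≤ (s + e) / r := by gcongr; linarith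
    rw [hx]; linarith
  · refine h2.trans (le_trans ?_ (neg_le_abs _))
    have : (t : ℝ) + 1 ≤ z := by exact_mod_cast h
    have h3 : ((r : ℝ) - s - 2) / r ≤ (r - (s + e)) / r :=
      div_le_div_of_nonneg_right (by linarith) hr'.le
    have h4 : ((r : ℝ) - (s + e)) / r = 1 - (s + e) / r := by field_simp
    rw [hx]; linarith

/-- With `r = q.den` and `c = ⌊r θ⌋`, the integers `q.num * k + c` run once through the residues
modulo `r`. Replacing `β` by `q` and `r θ` by `c` moves `r (β k + θ)` by an amount in `[-1, 2]`, so
the points are spaced essentially like the multiples of `1 / r`, and the kernels sum to a harmonic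
sum. -/
lemma sum_linKernel_block {β M : ℝ} (θ : ℝ) (hM : 0 ≤ M) {q : ℚ}
    (hq : |β - q| ≤ 1 / (q.den : ℝ) ^ 2) :
    ∑ k ∈ Finset.range q.den, linKernel M (β * k + θ) ≤
      8 * M + 2 * q.den * (1 + Real.log q.den) := by
  have hr : 0 < q.den := q.pos
  set r := q.den with hrdef
  have hr' : (0 : ℝ) < r := by exact_mod_cast hr
  have hqr : (q : ℝ) = q.num / r := by
    rw [hrdef]; exact Rat.cast_def q
  set c := ⌊r * θ⌋ with hc
  let s : ℕ → ℕ := fun k => ((q.num * k + c) % (r : ℤ)).toNat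
  have hsr (k : ℕ) : ((s k : ℕ) : ℤ) = (q.num * k + c) % (r : ℤ) :=
    Int.toNat_of_nonneg (Int.emod_nonneg _ (by omega))
  have hslt (k : ℕ) : s k < r := by
    have := Int.emod_lt_of_pos (q.num * k + c) (show (0 : ℤ) < r by omega)
    have := hsr k
    omega
  have hinj : Set.InjOn s (Finset.range r) := by
    intro k hk k' hk' h
    have hk := Finset.mem_range.mp (Finset.mem_coe.mp hk)
    have hk' := Finset.mem_range.mp (Finset.mem_coe.mp hk')
    have h1 : (q.num * k + c) % (r : ℤ) = (q.num * k' + c) % (r : ℤ) := by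
      rw [← hsr, ← hsr, h]
    have h2 : (r : ℤ) ∣ q.num * ((k' : ℤ) - k) := by
      rw [show q.num * ((k' : ℤ) - k) = (q.num * k' + c) - (q.num * k + c) by ring]
      exact Int.ModEq.dvd h1
    have hcop : IsCoprime (r : ℤ) q.num := by
      rw [Int.isCoprime_iff_gcd_eq_one, Int.gcd_comm]
      exact q.reduced
    have h3 := hcop.dvd_of_dvd_mul_left h2
    have h4 := Int.eq_zero_of_abs_lt_dvd h3 (by rw [abs_lt]; omega)
    omega
  -- Majorant by residue: the four residues whose points may come arbitrarily close to an integer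
  -- get the trivial bound `2 M`. Truncated subtraction and `1 / 0 = 0` make each harmonic term
  -- vanish at the two residues at its own end.
  let g : ℕ → ℝ := fun j => (if j = 0 then 2 * M else 0) + (if j = 1 then 2 * M else 0) +
    (if j = r - 1 then 2 * M else 0) + (if j = r - 2 then 2 * M else 0) +
    r * (1 / ((j - 1 : ℕ) : ℝ)) + r * (1 / ((r - 1 - j - 1 : ℕ) : ℝ))
  have hg0 (j : ℕ) : 0 ≤ g j := by
    have : ∀ P : Prop, [Decidable P] → 0 ≤ (if P then 2 * M else 0) := by
      intro P _; split_ifs <;> positivity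
    have h5 : (0 : ℝ) ≤ r * (1 / ((j - 1 : ℕ) : ℝ)) := by positivity
    have h6 : (0 : ℝ) ≤ r * (1 / ((r - 1 - j - 1 : ℕ) : ℝ)) := by positivity
    have e1 := this (j = 0); have e2 := this (j = 1)
    have e3 := this (j = r - 1); have e4 := this (j = r - 2)
    simp only [g]
    linarith
  have hterm : ∀ k ∈ Finset.range r, linKernel M (β * k + θ) ≤ g (s k) := by
    intro k hk
    have hk := Finset.mem_range.mp hk
    have hk' : (k : ℝ) ≤ r := by exact_mod_cast hk.le
    have hsk := hslt k
    have ite0 : ∀ P : Prop, [Decidable P] → 0 ≤ (if P then 2 * M else 0) := by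
      intro P _; split_ifs <;> positivity
    have h5 : (0 : ℝ) ≤ r * (1 / ((s k - 1 : ℕ) : ℝ)) := by positivity
    have h6 : (0 : ℝ) ≤ r * (1 / ((r - 1 - s k - 1 : ℕ) : ℝ)) := by positivity
    have e1 := ite0 (s k = 0); have e2 := ite0 (s k = 1)
    have e3 := ite0 (s k = r - 1); have e4 := ite0 (s k = r - 2)
    by_cases hb : s k = 0 ∨ s k = 1 ∨ s k = r - 1 ∨ s k = r - 2
    · refine (linKernel_le_two_mul hM _).trans ?_
      simp only [g]
      rcases hb with h | h | h | h
      · rw [if_pos h] at e1 ⊢; linarith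
      · rw [if_pos h] at e2 ⊢; linarith
      · rw [if_pos h] at e3 ⊢; linarith
      · rw [if_pos h] at e4 ⊢; linarith
    · push Not at hb
      have hs2 : 2 ≤ s k := by omega
      have hs3 : s k + 3 ≤ r := by omega
      have hs2' : (2 : ℝ) ≤ s k := by exact_mod_cast hs2
      have hs3' : (s k : ℝ) + 3 ≤ r := by exact_mod_cast hs3
      set e := (r * θ - c) + r * (β - q) * k with he
      have hf0 : 0 ≤ r * θ - c := by have := Int.floor_le (r * θ); linarith
      have hf1 : r * θ - c ≤ 1 := by have := (Int.lt_floor_add_one (r * θ)).le; linarith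
      have habs : |r * (β - q) * k| ≤ 1 := by
        rw [abs_mul, abs_mul, abs_of_pos hr', Nat.abs_cast]
        calc (r : ℝ) * |β - q| * k ≤ r * (1 / (r : ℝ) ^ 2) * r := by gcongr
          _ = 1 := by field_simp
      rw [abs_le] at habs
      have hdiv : q.num * k + c = (s k : ℤ) + r * ((q.num * k + c) / (r : ℤ)) := by
        rw [hsr]; exact (Int.emod_add_mul_ediv _ _).symm
      set t := (q.num * k + c) / (r : ℤ)
      have hdiv' : (q.num : ℝ) * k + c = s k + r * t := by exact_mod_cast hdiv
      have hx : β * k + θ = (s k + e) / r + t := by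
        rw [eq_comm, div_add' _ _ _ hr'.ne', div_eq_iff hr'.ne', he, hqr]
        have : (r : ℝ) * (β - q.num / r) * k = r * β * k - q.num * k := by field_simp
        rw [this]; linarith
      have hd := distInt_ge_of_residue hr (by linarith) (by linarith) hx
      have c1 : ((s k - 1 : ℕ) : ℝ) = s k - 1 := by push_cast [show 1 ≤ s k by omega]; ring
      have c2 : ((r - 1 - s k - 1 : ℕ) : ℝ) = r - s k - 2 := by
        rw [show r - 1 - s k - 1 = r - (s k + 2) by omega, Nat.cast_sub (by omega)]
        push_cast; ring
      have key : linKernel M (β * k + θ) ≤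
          r * (1 / ((s k - 1 : ℕ) : ℝ)) + r * (1 / ((r - 1 - s k - 1 : ℕ) : ℝ)) := by
        rw [c1] at h5
        rw [c2] at h6
        rw [c1, c2]
        rcases le_total ((s k : ℝ) - 1) (r - s k - 2) with h | h
        · have := linKernel_le_inv hM (div_pos (by linarith) hr')
            (hd (((s k : ℝ) - 1) / r) le_rfl (by gcongr))
          rw [one_div_div, ← mul_one_div] at this
          linarith
        · have := linKernel_le_inv hM (div_pos (by linarith) hr')
            (hd (((r : ℝ) - s k - 2) / r) (by gcongr) le_rfl)
          rw [one_div_div, ← mul_one_div] at this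
          linarith
      simp only [g]
      linarith
  have hsum1 := sum_range_one_div_pred_le hr
  have hsum2 : ∑ j ∈ Finset.range r, 1 / ((r - 1 - j - 1 : ℕ) : ℝ) ≤ 1 + Real.log r := by
    rw [Finset.sum_range_reflect (fun j => 1 / ((j - 1 : ℕ) : ℝ)) r]
    exact hsum1
  have hite (a : ℕ) : ∑ j ∈ Finset.range r, (if j = a then 2 * M else 0) ≤ 2 * M := by
    rw [Finset.sum_ite_eq']
    split_ifs <;> linarith
  calc ∑ k ∈ Finset.range r, linKernel M (β * k + θ) ≤ ∑ k ∈ Finset.range r, g (s k) :=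
        Finset.sum_le_sum hterm
    _ = ∑ j ∈ (Finset.range r).image s, g j := (Finset.sum_image hinj).symm
    _ ≤ ∑ j ∈ Finset.range r, g j := by
        refine Finset.sum_le_sum_of_subset_of_nonneg ?_ fun j _ _ => hg0 j
        intro j hj
        obtain ⟨k, _, rfl⟩ := Finset.mem_image.mp hj
        exact Finset.mem_range.mpr (hslt k)
    _ ≤ 8 * M + 2 * r * (1 + Real.log r) := by
        simp only [g, Finset.sum_add_distrib, ← Finset.mul_sum]
        have := hite 0; have := hite 1; have := hite (r - 1); have := hite (r - 2)
        have := mul_le_mul_of_nonneg_left hsum1 hr'.le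
        have := mul_le_mul_of_nonneg_left hsum2 hr'.le
        linarith

lemma sum_linKernel_le {β M : ℝ} (θ : ℝ) (hM : 0 ≤ M) {q : ℚ}
    (hq : |β - q| ≤ 1 / (q.den : ℝ) ^ 2) (N : ℕ) :
    ∑ k ∈ Finset.range N, linKernel M (β * k + θ) ≤
      (N / q.den + 1) * (8 * M + 2 * q.den * (1 + Real.log q.den)) := by
  have hr : 0 < q.den := q.pos
  have hB : 0 ≤ 8 * M + 2 * q.den * (1 + Real.log q.den) :=
    (Finset.sum_nonneg fun k _ => linKernel_nonneg hM _).trans (sum_linKernel_block 0 hM hq)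
  have hmul (t : ℕ) : ∑ k ∈ Finset.range (q.den * t), linKernel M (β * k + θ) ≤
      t * (8 * M + 2 * q.den * (1 + Real.log q.den)) := by
    induction t with
    | zero => simp
    | succ t ih =>
      rw [Nat.mul_succ, Finset.sum_range_add]
      have h := sum_linKernel_block (β * (q.den * t : ℕ) + θ) hM hq
      have h2 : ∑ k ∈ Finset.range q.den, linKernel M (β * k + (β * (q.den * t : ℕ) + θ)) =
          ∑ k ∈ Finset.range q.den, linKernel M (β * (q.den * t + k : ℕ) + θ) := by
        refine Finset.sum_congr rfl fun k _ => ?_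
        congr 1; push_cast; ring
      rw [h2] at h
      push_cast at h ih ⊢
      linarith
  calc ∑ k ∈ Finset.range N, linKernel M (β * k + θ)
      ≤ ∑ k ∈ Finset.range (q.den * (N / q.den + 1)), linKernel M (β * k + θ) := by
        refine Finset.sum_le_sum_of_subset_of_nonneg ?_ fun k _ _ => linKernel_nonneg hM _
        exact Finset.range_subset_range.mpr (Nat.lt_mul_div_succ N hr).le
    _ ≤ _ := hmul _
    _ ≤ _ := by
        refine mul_le_mul_of_nonneg_right ?_ hB
        push_cast
        gcongr
        exact Nat.cast_div_le

/-! ### Completion of intervals and bilinear sums. -/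

/-- This is the logarithmic loss in completion: the block bound with `β = 1 / P` approximated
exactly. -/
lemma sum_linKernel_div_le {P : ℕ} (hP : 0 < P) :
    ∑ k ∈ Finset.range P, linKernel P (k / P) / P ≤ 10 * (1 + Real.log P) := by
  have hP' : (0 : ℝ) < P := by exact_mod_cast hP
  have hden : ((P : ℚ)⁻¹).den = P := Rat.inv_natCast_den_of_pos hP
  have h := sum_linKernel_block (β := (P : ℝ)⁻¹) (M := P) 0 hP'.le (q := (P : ℚ)⁻¹) (by
    rw [hden]; push_cast; rw [sub_self, abs_zero]; positivity)
  rw [hden] at h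
  rw [← Finset.sum_div, div_le_iff₀ hP']
  have h2 : ∑ k ∈ Finset.range P, linKernel P (k / P) =
      ∑ k ∈ Finset.range P, linKernel P ((P : ℝ)⁻¹ * k + 0) := by
    refine Finset.sum_congr rfl fun k _ => ?_
    rw [add_zero, div_eq_inv_mul]
  rw [h2]
  refine h.trans ?_
  have := Real.log_nonneg (show (1 : ℝ) ≤ P by exact_mod_cast hP)
  nlinarith

lemma sum_range_expi_orthogonal {P A n l : ℕ} (hn : n ∈ Finset.Ico A (A + P))
    (hl : l ∈ Finset.Ico A (A + P)) :
    ∑ k ∈ Finset.range P, expi (n * (k / P)) * expi (-(l * (k / P))) =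
      if n = l then (P : ℂ) else 0 := by
  rw [Finset.mem_Ico] at hn hl
  have hP : 0 < P := by omega
  have hP' : (P : ℝ) ≠ 0 := by positivity
  have h1 (k : ℕ) : expi (n * (k / P)) * expi (-(l * (k / P))) = expi (((n : ℝ) - l) / P) ^ k := by
    rw [← expi_add, ← expi_nat_mul]
    congr 1; field_simp; ring
  simp_rw [h1]
  split_ifs with h
  · subst h; simp [expi_zero]
  · have hne : expi (((n : ℝ) - l) / P) ≠ 1 := by
      intro h2
      have h3 := four_mul_distInt_le (((n : ℝ) - l) / P)
      rw [h2, sub_self, norm_zero] at h3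
      have h4 : distInt (((n : ℝ) - l) / P) = 0 := le_antisymm (by linarith) (distInt_nonneg _)
      rw [distInt, abs_eq_zero, sub_eq_zero, div_eq_iff hP'] at h4
      have h5 : (n : ℤ) - l = round (((n : ℝ) - l) / P) * P := by exact_mod_cast h4
      have h6 := Int.eq_zero_of_abs_lt_dvd (Dvd.intro_left _ h5.symm) (by rw [abs_lt]; omega)
      omega
    rw [geom_sum_eq hne, ← expi_nat_mul, mul_div_cancel₀ _ hP']
    have : expi ((n : ℝ) - l) = 1 := by
      have := expi_int ((n : ℤ) - l)
      push_cast at this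
      exact this
    rw [this]; simp

/-- Orthogonality of the additive characters modulo `P` detects `n ∈ S`, and the Fourier
coefficients of an interval are geometric sums. The weights on the right no longer depend on `S`, so
an interval varying with an outer variable can be removed. -/
lemma norm_sum_le_completion {P A : ℕ} (hP : 0 < P) {S : Finset ℕ}
    (hS : (S : Set ℕ).OrdConnected) (hSA : S ⊆ Finset.Ico A (A + P)) (f : ℕ → ℂ) :
    ‖∑ n ∈ S, f n‖ ≤ ∑ k ∈ Finset.range P, linKernel P (k / P) / P *
      ‖∑ n ∈ Finset.Ico A (A + P), f n * expi (n * (k / P))‖ := by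
  have hP' : (P : ℂ) ≠ 0 := by exact_mod_cast hP.ne'
  have hcard : (S.card : ℝ) ≤ P := by
    have := Finset.card_le_card hSA
    rw [Nat.card_Ico] at this
    exact_mod_cast (show S.card ≤ P by omega)
  have h1 : ∑ n ∈ S, f n = ∑ k ∈ Finset.range P,
      (∑ l ∈ S, expi (-(l * (k / P)))) / P *
        ∑ n ∈ Finset.Ico A (A + P), f n * expi (n * (k / P)) := by
    have : ∀ n ∈ Finset.Ico A (A + P), (if n ∈ S then f n else 0) =
        ∑ k ∈ Finset.range P, ∑ l ∈ S,
          expi (-(l * (k / P))) / P * (f n * expi (n * (k / P))) := by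
      intro n hn
      rw [Finset.sum_comm]
      have h2 : ∀ l ∈ S, ∑ k ∈ Finset.range P,
          expi (-(l * (k / P))) / P * (f n * expi (n * (k / P))) = if n = l then f n else 0 := by
        intro l hl
        have h3 := sum_range_expi_orthogonal hn (hSA hl)
        calc _ = f n / P * ∑ k ∈ Finset.range P, expi (n * (k / P)) * expi (-(l * (k / P))) := by
              rw [Finset.mul_sum]
              refine Finset.sum_congr rfl fun k _ => ?_
              ring
          _ = _ := by
              rw [h3]; split_ifs
              · field_simp
              · simp
      rw [Finset.sum_congr rfl h2, Finset.sum_ite_eq]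
    calc ∑ n ∈ S, f n = ∑ n ∈ S, (if n ∈ S then f n else 0) :=
          Finset.sum_congr rfl fun n hn => (if_pos hn).symm
      _ = ∑ n ∈ Finset.Ico A (A + P), (if n ∈ S then f n else 0) :=
          Finset.sum_subset hSA fun n _ hn => if_neg hn
      _ = _ := by
          rw [Finset.sum_congr rfl this, Finset.sum_comm]
          refine Finset.sum_congr rfl fun k _ => ?_
          rw [Finset.mul_sum]
          refine Finset.sum_congr rfl fun n _ => ?_
          rw [Finset.sum_div, Finset.sum_mul]
  rw [h1]
  refine (norm_sum_le _ _).trans (Finset.sum_le_sum fun k _ => ?_)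
  rw [norm_mul, norm_div, Complex.norm_natCast]
  gcongr
  have h2 := norm_sum_expi_le_of_ordConnected hS hcard (-((k : ℝ) / P))
  rw [linKernel_neg] at h2
  simp_rw [mul_neg] at h2
  exact h2

/-- Expand the square and sum over `m` first. For fixed `n` the frequencies `β (n - l)` form an
arithmetic progression in `l`, so the kernel sum applies. -/
lemma sum_norm_sq_le {c : ℕ → ℂ} (hc : ∀ n, ‖c n‖ ≤ 1) {β : ℝ} {q : ℚ}
    (hq : |β - q| ≤ 1 / (q.den : ℝ) ^ 2) (A P M : ℕ) :
    ∑ m ∈ Finset.Ico 1 (M + 1), ‖∑ n ∈ Finset.Ico A (A + P), c n * expi (β * m * n)‖ ^ 2 ≤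
      P * ((P / q.den + 1) * (8 * M + 2 * q.den * (1 + Real.log q.den))) := by
  set T := ∑ m ∈ Finset.Ico 1 (M + 1), ‖∑ n ∈ Finset.Ico A (A + P), c n * expi (β * m * n)‖ ^ 2
    with hT
  have hT0 : 0 ≤ T := Finset.sum_nonneg fun _ _ => by positivity
  have h1 : (T : ℂ) = ∑ n ∈ Finset.Ico A (A + P), ∑ l ∈ Finset.Ico A (A + P),
      c n * (starRingEnd ℂ) (c l) * ∑ m ∈ Finset.Ico 1 (M + 1), expi (m * (β * (n - l))) := by
    rw [hT]
    push_cast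
    simp_rw [← Complex.mul_conj', map_sum, Finset.sum_mul_sum]
    rw [Finset.sum_comm]
    refine Finset.sum_congr rfl fun n _ => ?_
    rw [Finset.sum_comm]
    refine Finset.sum_congr rfl fun l _ => ?_
    rw [Finset.mul_sum]
    refine Finset.sum_congr rfl fun m _ => ?_
    rw [map_mul, conj_expi,
      show (m : ℝ) * (β * (n - l)) = β * m * n + (-(β * m * l)) by ring, expi_add]
    ring
  have h2 : T = ‖(T : ℂ)‖ := by rw [Complex.norm_real, Real.norm_of_nonneg hT0]
  rw [h2, h1]
  refine (norm_sum_le _ _).trans ?_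
  have h3 : ∀ n ∈ Finset.Ico A (A + P), ‖∑ l ∈ Finset.Ico A (A + P),
      c n * (starRingEnd ℂ) (c l) * ∑ m ∈ Finset.Ico 1 (M + 1), expi (m * (β * (n - l)))‖ ≤
      (P / q.den + 1) * (8 * M + 2 * q.den * (1 + Real.log q.den)) := by
    intro n _
    refine (norm_sum_le _ _).trans ?_
    refine le_trans ?_ (sum_linKernel_le (β * (A - n)) (Nat.cast_nonneg M) hq P)
    rw [Finset.sum_Ico_eq_sum_range, Nat.add_sub_cancel_left]
    refine Finset.sum_le_sum fun k _ => ?_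
    have h4 := norm_sum_Ico_expi_le 1 (M + 1) (β * (n - (A + k : ℕ)))
    rw [Nat.add_sub_cancel, ← linKernel_neg] at h4
    rw [norm_mul, norm_mul, RCLike.norm_conj]
    calc ‖c n‖ * ‖c (A + k)‖ * _ ≤ 1 * 1 * linKernel M (-(β * (n - (A + k : ℕ)))) := by
          gcongr
          · exact hc n
          · exact hc _
      _ = _ := by
          rw [one_mul, one_mul]; congr 1; push_cast; ring
  refine (Finset.sum_le_sum h3).trans ?_
  simp

/-- Completion replaces `S m` by the full block at the price of a twist `expi (n k / P)`. The twist
is absorbed into the bounded coefficients, and Cauchy–Schwarz over `m` leads to the mean square. -/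
lemma sum_norm_block_le {b : ℕ → ℂ} (hb : ∀ n, ‖b n‖ ≤ 1) {β : ℝ} {q : ℚ}
    (hq : |β - q| ≤ 1 / (q.den : ℝ) ^ 2) {A P : ℕ} (M : ℕ) (hP : 0 < P) {S : ℕ → Finset ℕ}
    (hS : ∀ m, (S m : Set ℕ).OrdConnected) (hSA : ∀ m, S m ⊆ Finset.Ico A (A + P)) :
    ∑ m ∈ Finset.Ico 1 (M + 1), ‖∑ n ∈ S m, b n * expi (β * m * n)‖ ≤
      10 * (1 + Real.log P) *
        √(M * (P * ((P / q.den + 1) * (8 * M + 2 * q.den * (1 + Real.log q.den))))) := by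
  set R := P * ((P / q.den + 1) * (8 * M + 2 * q.den * (1 + Real.log q.den))) with hR
  calc ∑ m ∈ Finset.Ico 1 (M + 1), ‖∑ n ∈ S m, b n * expi (β * m * n)‖
      ≤ ∑ m ∈ Finset.Ico 1 (M + 1), ∑ k ∈ Finset.range P, linKernel P (k / P) / P *
        ‖∑ n ∈ Finset.Ico A (A + P), b n * expi (β * m * n) * expi (n * (k / P))‖ :=
        Finset.sum_le_sum fun m _ => norm_sum_le_completion hP (hS m) (hSA m) _
    _ = ∑ k ∈ Finset.range P, linKernel P (k / P) / P * ∑ m ∈ Finset.Ico 1 (M + 1),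
        ‖∑ n ∈ Finset.Ico A (A + P), (b n * expi (n * (k / P))) * expi (β * m * n)‖ := by
        rw [Finset.sum_comm]
        refine Finset.sum_congr rfl fun k _ => ?_
        rw [Finset.mul_sum]
        refine Finset.sum_congr rfl fun m _ => ?_
        simp_rw [mul_right_comm]
    _ ≤ ∑ k ∈ Finset.range P, linKernel P (k / P) / P * √(M * R) := by
        refine Finset.sum_le_sum fun k _ => ?_
        refine mul_le_mul_of_nonneg_left ?_
          (div_nonneg (linKernel_nonneg (Nat.cast_nonneg _) _) (Nat.cast_nonneg _))
        apply Real.le_sqrt_of_sq_le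
        have h1 := sum_norm_sq_le (c := fun n => b n * expi (n * (k / P)))
          (fun n => by rw [norm_mul, norm_expi, mul_one]; exact hb n) hq A P M
        have h2 := Finset.sum_mul_sq_le_sq_mul_sq (Finset.Ico 1 (M + 1)) (fun _ => (1 : ℝ))
          (fun m : ℕ => ‖∑ n ∈ Finset.Ico A (A + P),
            (b n * expi (n * (k / P))) * expi (β * m * n)‖)
        simp only [one_mul, one_pow, Finset.sum_const, Nat.card_Ico, Nat.add_sub_cancel,
          nsmul_eq_mul, mul_one] at h2
        exact h2.trans (mul_le_mul_of_nonneg_left h1 (Nat.cast_nonneg _))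
    _ ≤ _ := by
        rw [← Finset.sum_mul]
        exact mul_le_mul_of_nonneg_right (sum_linKernel_div_le hP) (Real.sqrt_nonneg _)

lemma Nat.log_two_floor_add_one_le {X : ℝ} (hX : 1 ≤ X) :
    ((Nat.log 2 ⌊X⌋₊ + 1 : ℕ) : ℝ) ≤ 2 * (1 + Real.log X) := by
  have h0 : ⌊X⌋₊ ≠ 0 := by
    have := Nat.le_floor (α := ℝ) (n := 1) (a := X) (by simpa using hX)
    omega
  have h1 : (2 : ℝ) ^ Nat.log 2 ⌊X⌋₊ ≤ X := by
    have := Nat.pow_log_le_self 2 h0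
    calc (2 : ℝ) ^ Nat.log 2 ⌊X⌋₊ ≤ (⌊X⌋₊ : ℝ) := by exact_mod_cast this
      _ ≤ X := Nat.floor_le (by linarith)
  have h2 := Real.log_le_log (by positivity) h1
  rw [Real.log_pow] at h2
  have h3 := Real.log_two_gt_d9
  have h4 : (0 : ℝ) ≤ Nat.log 2 ⌊X⌋₊ := Nat.cast_nonneg _
  push_cast
  nlinarith

/-- The hypotheses make each of `X / q.den`, `A`, `q.den` and `M` at most `X / Z`. These are the
sizes, up to logarithms, of the four terms of the mean-square bound, so the square root saves `√Z`.
-/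
lemma bilinear_block_le {X Z β : ℝ} {q : ℚ} (hZ : 1 ≤ Z)
    (hq : |β - q| ≤ 1 / (q.den : ℝ) ^ 2) (hZr : Z ≤ q.den) (hrX : q.den * Z ≤ X)
    {b : ℕ → ℂ} (hb : ∀ n, ‖b n‖ ≤ 1) {A : ℕ} (hA : Z ≤ A) (hAX : A * Z ≤ X) {S : ℕ → Finset ℕ}
    (hS : ∀ m, (S m : Set ℕ).OrdConnected) (hSA : ∀ m, S m ⊆ Finset.Ico A (A + A)) :
    ∑ m ∈ Finset.Ico 1 (⌊X / A⌋₊ + 1), ‖∑ n ∈ S m, b n * expi (β * m * n)‖ ≤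
      50 * (1 + Real.log X) ^ 2 * (X / √Z) := by
  have hr : (0 : ℝ) < q.den := by linarith
  have hA0 : (0 : ℝ) < A := by linarith
  have hA1 : 0 < A := by exact_mod_cast hA0
  have hX : 1 ≤ X := by nlinarith
  set r : ℝ := (q.den : ℝ) with hrdef
  have hrX' : r ≤ X := by nlinarith
  have hAX' : (A : ℝ) ≤ X := by nlinarith
  set l := 1 + Real.log X with hl
  have hl1 : 1 ≤ l := by have := Real.log_nonneg hX; linarith
  have hlA : 1 + Real.log A ≤ l := by
    have := Real.log_le_log hA0 hAX'; linarith
  have hlr : 1 + Real.log r ≤ l := by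
    have := Real.log_le_log hr hrX'; linarith
  set M := ⌊X / A⌋₊ with hM
  have hMX : (M : ℝ) ≤ X / A := Nat.floor_le (by positivity)
  refine (sum_norm_block_le hb hq M hA1 hS hSA).trans ?_
  have hZ0 : 0 < Z := by linarith
  set W := X / Z with hW
  have hW0 : 0 ≤ W := by positivity
  have k1 : A * M ≤ X := by rw [le_div_iff₀ hA0] at hMX; linarith
  have k2 : X / r ≤ W := by rw [hW]; gcongr
  have k3 : (A : ℝ) ≤ W := by rw [hW, le_div_iff₀ hZ0]; exact hAX
  have k4 : r ≤ W := by rw [hW, le_div_iff₀ hZ0]; exact hrX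
  have k5 : (M : ℝ) ≤ W := hMX.trans (by rw [hW]; gcongr)
  have k6 : (A / r + 1) * (8 * M + 2 * r * (1 + Real.log r)) ≤ 20 * l * W := by
    calc (A / r + 1) * (8 * M + 2 * r * (1 + Real.log r))
        ≤ (A / r + 1) * (8 * M + 2 * r * l) := by gcongr
      _ = 8 * (A * M / r) + 2 * A * l + 8 * M + 2 * r * l := by field_simp; ring
      _ ≤ 8 * (X / r) + 2 * A * l + 8 * M + 2 * r * l := by gcongr
      _ ≤ 8 * W + 2 * W * l + 8 * W + 2 * W * l := by gcongr
      _ ≤ 20 * l * W := by nlinarith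
  have k7 : M * (A * ((A / r + 1) * (8 * M + 2 * r * (1 + Real.log r)))) ≤
      (5 * l * (X / √Z)) ^ 2 := by
    calc M * (A * ((A / r + 1) * (8 * M + 2 * r * (1 + Real.log r))))
        = (A * M) * ((A / r + 1) * (8 * M + 2 * r * (1 + Real.log r))) := by ring
      _ ≤ X * (20 * l * W) := by gcongr
      _ = 20 * l * (X ^ 2 / Z) := by rw [hW]; ring
      _ ≤ 25 * l ^ 2 * (X ^ 2 / Z) := by gcongr <;> nlinarith
      _ = _ := by rw [mul_pow, div_pow, Real.sq_sqrt hZ0.le]; ring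
  have k8 := Real.sqrt_le_sqrt k7
  rw [Real.sqrt_sq (by positivity)] at k8
  calc _ ≤ 10 * l * (5 * l * (X / √Z)) := by gcongr
    _ = _ := by ring

/-- A bilinear (type II) exponential sum estimate, where the inner variable is restricted to an
interval depending on the outer variable. -/
lemma bilinear_le {X Z β : ℝ} {q : ℚ} (hZ : 1 ≤ Z)
    (hq : |β - q| ≤ 1 / (q.den : ℝ) ^ 2) (hZr : Z ≤ q.den) (hrX : q.den * Z ≤ X)
    {b : ℕ → ℂ} (hb : ∀ n, ‖b n‖ ≤ 1) {Ms : Finset ℕ} (hMs : ∀ m ∈ Ms, Z ≤ m) {S : ℕ → Finset ℕ}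
    (hS : ∀ m, (S m : Set ℕ).OrdConnected)
    (hSZ : ∀ m ∈ Ms, ∀ n ∈ S m, Z ≤ n ∧ (m * n : ℝ) ≤ X) :
    ∑ m ∈ Ms, ‖∑ n ∈ S m, b n * expi (β * m * n)‖ ≤
      100 * (1 + Real.log X) ^ 3 * (X / √Z) := by
  have hX : 1 ≤ X := by nlinarith
  set A₀ := ⌈Z⌉₊ with hA₀
  have hA₀1 : 0 < A₀ := Nat.ceil_pos.mpr (by linarith)
  set I := Nat.log 2 ⌊X⌋₊ + 1 with hI
  have hl0 := Real.log_nonneg hX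
  have hdecomp : ∀ m ∈ Ms, ‖∑ n ∈ S m, b n * expi (β * m * n)‖ ≤
      ∑ i ∈ Finset.range I, ‖∑ n ∈ (S m).filter
        (fun n => n ∈ Finset.Ico (A₀ * 2 ^ i) (A₀ * 2 ^ i + A₀ * 2 ^ i)),
          b n * expi (β * m * n)‖ := by
    intro m hm
    refine le_trans (le_of_eq ?_) (norm_sum_le _ _)
    congr 1
    -- Dyadic decomposition of `n`, starting at `A₀ = ⌈Z⌉₊`: the block index is the binary logarithm
    -- of `n / A₀`.
    rw [← Finset.sum_fiberwise_of_maps_to (s := S m) (t := Finset.range I)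
      (g := fun n => Nat.log 2 (n / A₀))]
    · refine Finset.sum_congr rfl fun i _ => ?_
      congr 1
      refine Finset.filter_congr fun n hn => ?_
      have hn0 : A₀ ≤ n := Nat.ceil_le.mpr (hSZ m hm n hn).1
      have hne : n / A₀ ≠ 0 := (Nat.div_pos hn0 hA₀1).ne'
      rw [Nat.log_eq_iff (Or.inr ⟨one_lt_two, hne⟩), Nat.le_div_iff_mul_le hA₀1,
        Nat.div_lt_iff_lt_mul hA₀1, Finset.mem_Ico, pow_succ]
      constructor <;> rintro ⟨h1, h2⟩ <;> constructor <;> nlinarith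
    · intro n hn
      obtain ⟨h1, h2⟩ := hSZ m hm n hn
      have hm1 : (1 : ℝ) ≤ m := hZ.trans (hMs m hm)
      have hnX : (n : ℝ) ≤ X := by nlinarith [Nat.cast_nonneg (α := ℝ) n]
      rw [Finset.mem_range, hI, Nat.lt_succ_iff]
      exact Nat.log_mono_right ((Nat.div_le_self _ _).trans (Nat.le_floor hnX))
  refine (Finset.sum_le_sum hdecomp).trans ?_
  rw [Finset.sum_comm]
  have hblock : ∀ i ∈ Finset.range I, ∑ m ∈ Ms, ‖∑ n ∈ (S m).filter
        (fun n => n ∈ Finset.Ico (A₀ * 2 ^ i) (A₀ * 2 ^ i + A₀ * 2 ^ i)),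
          b n * expi (β * m * n)‖ ≤ 50 * (1 + Real.log X) ^ 2 * (X / √Z) := by
    intro i _
    set A := A₀ * 2 ^ i with hA
    have hAZ : Z ≤ A := by
      have h1 : A₀ ≤ A := Nat.le_mul_of_pos_right _ (by positivity)
      exact (Nat.le_ceil Z).trans (by exact_mod_cast h1)
    have hA0 : (0 : ℝ) < A := by linarith
    set T : ℕ → Finset ℕ := fun m => (S m).filter (fun n => n ∈ Finset.Ico A (A + A)) with hT
    have hTmem {m n : ℕ} (h : n ∈ T m) : n ∈ S m ∧ A ≤ n := by
      rw [hT, Finset.mem_filter, Finset.mem_Ico] at h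
      exact ⟨h.1, h.2.1⟩
    -- A nonempty block contains some `n ≥ A` paired with an `m ≥ Z`, hence `A Z ≤ m n ≤ X`. The
    -- same comparison puts every contributing `m` below `X / A`.
    by_cases hex : ∃ m ∈ Ms, (T m).Nonempty
    · obtain ⟨m₀, hm₀, n₀, hn₀⟩ := hex
      obtain ⟨hn₀S, hn₀A⟩ := hTmem hn₀
      have hAX : A * Z ≤ X := by
        have h1 := (hSZ m₀ hm₀ n₀ hn₀S).2
        have h2 := hMs m₀ hm₀
        have h3 : (A : ℝ) ≤ n₀ := by exact_mod_cast hn₀A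
        calc A * Z ≤ n₀ * m₀ := by gcongr
          _ ≤ X := by linarith
      have hTo : ∀ m, (T m : Set ℕ).OrdConnected := by
        intro m
        have : (T m : Set ℕ) = (S m : Set ℕ) ∩ Set.Ico A (A + A) := by
          ext n; simp [hT]
        rw [this]
        exact (hS m).inter Set.ordConnected_Ico
      refine le_trans ?_ (bilinear_block_le hZ hq hZr hrX hb hAZ hAX hTo
        (fun m n hn => (Finset.mem_filter.mp hn).2))
      rw [← Finset.sum_filter_of_ne (p := fun m => (T m).Nonempty)]
      · refine Finset.sum_le_sum_of_subset_of_nonneg ?_ fun _ _ _ => norm_nonneg _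
        intro m hm
        obtain ⟨hm1, n, hn⟩ := Finset.mem_filter.mp hm
        obtain ⟨hnS, hnA⟩ := hTmem hn
        have h1 := (hSZ m hm1 n hnS).2
        have h2 := hMs m hm1
        have h3 : (A : ℝ) ≤ n := by exact_mod_cast hnA
        rw [Finset.mem_Ico, Nat.lt_succ_iff]
        constructor
        · have : (1 : ℝ) ≤ m := by linarith
          exact_mod_cast this
        · apply Nat.le_floor
          rw [le_div_iff₀ hA0]
          calc (m : ℝ) * A ≤ m * n := by gcongr
            _ ≤ X := h1
      · intro m _ hne
        by_contra hemp
        rw [Finset.not_nonempty_iff_eq_empty] at hemp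
        apply hne
        change ‖∑ n ∈ T m, _‖ = 0
        rw [hemp]; simp
    · push Not at hex
      rw [Finset.sum_eq_zero]
      · positivity
      · intro m hm
        change ‖∑ n ∈ T m, _‖ = 0
        rw [hex m hm]
        simp
  refine (Finset.sum_le_sum hblock).trans ?_
  rw [Finset.sum_const, Finset.card_range, nsmul_eq_mul]
  have := Nat.log_two_floor_add_one_le hX
  calc (I : ℝ) * (50 * (1 + Real.log X) ^ 2 * (X / √Z))
      ≤ (2 * (1 + Real.log X)) * (50 * (1 + Real.log X) ^ 2 * (X / √Z)) := by gcongr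
    _ = _ := by ring

/-! ### Vinogradov's sieve method: integers without small prime factors, and primes. -/

/-- The sum of `1 / d` over the `d ∈ (D, X]` all of whose prime factors are less than `Z`. -/
noncomputable def smoothTail (Z D X : ℝ) : ℝ :=
  ∑ d ∈ (Nat.smoothNumbersUpTo ⌊X⌋₊ ⌈Z⌉₊).filter (fun d : ℕ => D < d), 1 / (d : ℝ)

/-- The product of the primes less than `Z`. -/
noncomputable def primeProd (Z : ℝ) : ℕ := ∏ p ∈ Nat.primesBelow ⌈Z⌉₊, p

lemma primeProd_ne_zero (Z : ℝ) : primeProd Z ≠ 0 :=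
  Finset.prod_ne_zero_iff.mpr fun _ hp => (Nat.prime_of_mem_primesBelow hp).ne_zero

lemma Nat.Prime.dvd_primeProd_iff {p : ℕ} (hp : p.Prime) (Z : ℝ) :
    p ∣ primeProd Z ↔ (p : ℝ) < Z := by
  rw [primeProd, hp.prime.dvd_finsetProd_iff]
  constructor
  · rintro ⟨l, hl, hpl⟩
    have h1 := Nat.prime_of_mem_primesBelow hl
    rw [(Nat.prime_dvd_prime_iff_eq hp h1).mp hpl]
    exact Nat.lt_ceil.mp (Nat.lt_of_mem_primesBelow hl)
  · intro h
    exact ⟨p, Nat.mem_primesBelow.mpr ⟨Nat.lt_ceil.mpr h, hp⟩, dvd_rfl⟩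

lemma coprime_primeProd_iff (n : ℕ) (Z : ℝ) :
    n.Coprime (primeProd Z) ↔ ∀ p : ℕ, p.Prime → p ∣ n → Z ≤ p := by
  constructor
  · intro h p hp hpn
    by_contra hlt
    exact Nat.not_coprime_of_dvd_of_dvd hp.one_lt hpn
      ((hp.dvd_primeProd_iff Z).mpr (not_le.mp hlt)) h
  · intro h
    refine Nat.coprime_of_dvd fun p hp hpn hpP => ?_
    exact absurd ((hp.dvd_primeProd_iff Z).mp hpP) (not_lt.mpr (h p hp hpn))

lemma mem_smoothNumbers_of_dvd_primeProd {d : ℕ} {Z : ℝ} (h : d ∣ primeProd Z) :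
    d ∈ Nat.smoothNumbers ⌈Z⌉₊ := by
  rw [Nat.mem_smoothNumbers']
  intro p hp hpd
  exact Nat.lt_ceil.mpr ((hp.dvd_primeProd_iff Z).mp (hpd.trans h))

lemma sum_moebius_gcd {n P : ℕ} (hP : P ≠ 0) :
    ∑ d ∈ P.divisors with d ∣ n, (ArithmeticFunction.moebius d : ℂ) =
      if n.Coprime P then 1 else 0 := by
  have h1 : P.divisors.filter (· ∣ n) = (n.gcd P).divisors := by
    ext d
    have : n.gcd P ≠ 0 := Nat.gcd_ne_zero_right hP
    simp only [Finset.mem_filter, Nat.mem_divisors, Nat.dvd_gcd_iff]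
    tauto
  rw [h1]
  have h2 := congrArg (fun f => f (n.gcd P)) ArithmeticFunction.moebius_mul_coe_zeta
  simp only [ArithmeticFunction.coe_mul_zeta_apply, ArithmeticFunction.one_apply] at h2
  have h3 := congrArg (Int.cast (R := ℂ)) h2
  push_cast at h3
  rw [h3]

/-- The quotients by `d` of the multiples of `d` in `S`. -/
def quotientSet (S : Finset ℕ) (d : ℕ) : Finset ℕ :=
  (Finset.range (S.sup id + 1)).filter fun k => d * k ∈ S

lemma mem_quotientSet {S : Finset ℕ} {d k : ℕ} (hd : 0 < d) :
    k ∈ quotientSet S d ↔ d * k ∈ S := by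
  rw [quotientSet, Finset.mem_filter, Finset.mem_range, and_iff_right_iff_imp]
  intro h
  have h1 : d * k ≤ S.sup id := Finset.le_sup (f := id) h
  nlinarith

lemma ordConnected_quotientSet {S : Finset ℕ} (hS : (S : Set ℕ).OrdConnected) (d : ℕ) :
    (quotientSet S d : Set ℕ).OrdConnected := by
  constructor
  intro a ha b hb k hk
  simp only [quotientSet, Finset.coe_filter, Finset.mem_range, Set.mem_ofPred_eq] at ha hb ⊢
  refine ⟨by have := hk.2; omega, ?_⟩
  exact hS.out ha.2 hb.2 ⟨Nat.mul_le_mul_left _ hk.1, Nat.mul_le_mul_left _ hk.2⟩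

lemma sum_filter_dvd_eq (S : Finset ℕ) {d : ℕ} (hd : 0 < d) (f : ℕ → ℂ) :
    ∑ n ∈ S with d ∣ n, f n = ∑ k ∈ quotientSet S d, f (d * k) := by
  refine Finset.sum_nbij' (fun n => n / d) (fun k => d * k) ?_ ?_ ?_ ?_ ?_
  · intro n hn
    obtain ⟨hn, hdn⟩ := Finset.mem_filter.mp hn
    rw [mem_quotientSet hd, Nat.mul_div_cancel' hdn]
    exact hn
  · intro k hk
    exact Finset.mem_filter.mpr ⟨(mem_quotientSet hd).mp hk, Dvd.intro _ rfl⟩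
  · intro n hn
    exact Nat.mul_div_cancel' (Finset.mem_filter.mp hn).2
  · intro k _
    exact Nat.mul_div_cancel_left _ hd
  · intro n hn
    rw [Nat.mul_div_cancel' (Finset.mem_filter.mp hn).2]

/-- Since `q` is in lowest terms and `d < q.den`, the number `q d` is at least `1 / q.den` from
every integer. Passing from `q` to `β` costs at most half of that. -/
lemma one_div_two_mul_den_le_distInt {β : ℝ} {q : ℚ} (hq : |β - q| ≤ 1 / (q.den : ℝ) ^ 2) {d : ℕ}
    (hd : 0 < d) (hdr : 2 * (d : ℝ) ≤ q.den) : 1 / (2 * (q.den : ℝ)) ≤ distInt (β * d) := by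
  have hr : (0 : ℝ) < q.den := by exact_mod_cast q.pos
  rw [distInt]
  set z := round (β * d)
  have hqr : (q : ℝ) = q.num / q.den := Rat.cast_def q
  have h1 : |(β - q) * d| ≤ 1 / (2 * (q.den : ℝ)) := by
    rw [abs_mul, Nat.abs_cast]
    calc |β - q| * d ≤ 1 / (q.den : ℝ) ^ 2 * (q.den / 2) := by gcongr; linarith
      _ = _ := by field_simp
  have h2 : q.num * d - q.den * z ≠ 0 := by
    intro h
    have hcop : IsCoprime (q.den : ℤ) q.num := by
      rw [Int.isCoprime_iff_gcd_eq_one, Int.gcd_comm]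
      exact q.reduced
    have h3 : (q.den : ℤ) ∣ d := hcop.dvd_of_dvd_mul_left ⟨z, by linarith⟩
    have h4 : q.den ≤ d := Nat.le_of_dvd hd (by exact_mod_cast h3)
    have h5 : (q.den : ℝ) ≤ d := by exact_mod_cast h4
    have : (0 : ℝ) < d := by exact_mod_cast hd
    linarith
  have h3 : 1 / (q.den : ℝ) ≤ |(q : ℝ) * d - z| := by
    have h4 : (1 : ℝ) ≤ |(q.num * d - q.den * z : ℝ)| := by
      exact_mod_cast Int.one_le_abs h2
    have h5 : (q * d - z : ℝ) = (q.num * d - q.den * z) / q.den := by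
      rw [hqr]; field_simp
    rw [h5, abs_div, abs_of_pos hr]
    gcongr
  have h4 : |(q : ℝ) * d - z| ≤ |β * d - z| + |(β - q) * d| := by
    have := abs_sub (β * d - z) ((β - q) * d)
    rwa [show β * d - z - (β - q) * d = q * d - z by ring] at this
  have h5 : 1 / (q.den : ℝ) = 1 / (2 * (q.den : ℝ)) + 1 / (2 * (q.den : ℝ)) := by
    field_simp; norm_num
  linarith

/-- The exponential sum over the integers in an interval without prime factors less than `Z`. -/
lemma norm_sum_rough_le {X Z β : ℝ} {q : ℚ} (hZ : 1 ≤ Z)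
    (hq : |β - q| ≤ 1 / (q.den : ℝ) ^ 2) (hZr : 2 * Z ≤ q.den) (hrX : q.den * Z ^ 2 ≤ X)
    {S : Finset ℕ} (hS : (S : Set ℕ).OrdConnected) (hSX : ∀ n ∈ S, 1 ≤ n ∧ (n : ℝ) ≤ X) :
    ‖∑ n ∈ S with n.Coprime (primeProd Z), expi (β * n)‖ ≤
      100 * (1 + Real.log X) ^ 3 * (X / √Z) + 3 * (X / Z) + X * smoothTail Z (X / Z ^ 2) X := by
  have hr : (0 : ℝ) < q.den := by linarith
  have hX : 1 ≤ X := by nlinarith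
  have hZ0 : 0 < Z := by linarith
  set D := X / Z ^ 2 with hD
  set Q := primeProd Z with hQ
  set T : ℕ → ℂ := fun d => ∑ k ∈ quotientSet S d, expi (β * d * k) with hT
  have hquot {d k : ℕ} (hd : 0 < d) (hk : k ∈ quotientSet S d) : 1 ≤ k ∧ (d * k : ℝ) ≤ X := by
    obtain ⟨h1, h2⟩ := hSX _ ((mem_quotientSet hd).mp hk)
    push_cast at h2
    exact ⟨Nat.pos_of_ne_zero (by rintro rfl; simp at h1), h2⟩
  have h1 : ∑ n ∈ S with n.Coprime Q, expi (β * n) =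
      ∑ d ∈ Q.divisors, (ArithmeticFunction.moebius d : ℂ) * T d := by
    calc ∑ n ∈ S with n.Coprime Q, expi (β * n)
        = ∑ n ∈ S, ∑ d ∈ Q.divisors,
          if d ∣ n then (ArithmeticFunction.moebius d : ℂ) * expi (β * n) else 0 := by
          rw [Finset.sum_filter]
          refine Finset.sum_congr rfl fun n _ => ?_
          rw [← Finset.sum_filter, ← Finset.sum_mul, sum_moebius_gcd (primeProd_ne_zero Z)]
          split_ifs <;> simp
      _ = _ := by
          rw [Finset.sum_comm]
          refine Finset.sum_congr rfl fun d hd => ?_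
          rw [← Finset.sum_filter, ← Finset.mul_sum,
            sum_filter_dvd_eq S (Nat.pos_of_mem_divisors hd)]
          congr 1
          refine Finset.sum_congr rfl fun k _ => ?_
          push_cast; ring_nf
  have h2 : ‖∑ n ∈ S with n.Coprime Q, expi (β * n)‖ ≤ ∑ d ∈ Q.divisors, ‖T d‖ := by
    rw [h1]
    refine (norm_sum_le _ _).trans (Finset.sum_le_sum fun d _ => ?_)
    rw [norm_mul]
    refine mul_le_of_le_one_left (norm_nonneg _) ?_
    rw [Complex.norm_intCast]
    exact_mod_cast ArithmeticFunction.abs_moebius_le_one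
  refine h2.trans ?_
  rw [← Finset.sum_filter_add_sum_filter_not Q.divisors (fun d : ℕ => (d : ℝ) < Z),
    ← Finset.sum_filter_add_sum_filter_not (Q.divisors.filter (fun d : ℕ => ¬ (d : ℝ) < Z))
      (fun d : ℕ => (d : ℝ) ≤ D), ← add_assoc]
  -- Small divisors: each inner sum is geometric and at most `2 q.den`. There are at most `Z` of
  -- them, and `q.den * Z ≤ X / Z`.
  have hsmall : ∑ d ∈ Q.divisors.filter (fun d : ℕ => (d : ℝ) < Z), ‖T d‖ ≤ 2 * (X / Z) := by
    have h3 : ∀ d ∈ Q.divisors.filter (fun d : ℕ => (d : ℝ) < Z), ‖T d‖ ≤ 2 * q.den := by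
      intro d hd
      obtain ⟨hd1, hd2⟩ := Finset.mem_filter.mp hd
      have hd0 := Nat.pos_of_mem_divisors hd1
      have h4 := norm_sum_expi_le_of_ordConnected (ordConnected_quotientSet hS d) le_rfl (β * d)
      have h5 := linKernel_le_inv (Nat.cast_nonneg (quotientSet S d).card) (by positivity)
        (one_div_two_mul_den_le_distInt hq hd0 (by linarith))
      rw [one_div_one_div] at h5
      refine le_trans (le_of_eq ?_) (h4.trans h5)
      rw [hT]
      congr 1
      exact Finset.sum_congr rfl fun k _ => by rw [mul_comm]
    have hcard : ((Q.divisors.filter (fun d : ℕ => (d : ℝ) < Z)).card : ℝ) ≤ Z := by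
      have : Q.divisors.filter (fun d : ℕ => (d : ℝ) < Z) ⊆ Finset.Icc 1 ⌊Z⌋₊ := by
        intro d hd
        obtain ⟨hd1, hd2⟩ := Finset.mem_filter.mp hd
        exact Finset.mem_Icc.mpr ⟨Nat.pos_of_mem_divisors hd1, Nat.le_floor hd2.le⟩
      have := Finset.card_le_card this
      rw [Nat.card_Icc, Nat.add_sub_cancel] at this
      exact (Nat.cast_le.mpr this).trans (Nat.floor_le hZ0.le)
    refine (Finset.sum_le_sum h3).trans ?_
    rw [Finset.sum_const, nsmul_eq_mul]
    have h6 : (q.den : ℝ) * Z ≤ X / Z := by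
      rw [le_div_iff₀ hZ0]; linarith
    nlinarith
  -- Middle divisors: bilinear in `d` and `k` once the fewer than `Z` values `k < Z` are dropped.
  -- The dropped terms total at most `D Z = X / Z`.
  have hmid : ∑ d ∈ (Q.divisors.filter (fun d : ℕ => ¬ (d : ℝ) < Z)).filter
      (fun d : ℕ => (d : ℝ) ≤ D), ‖T d‖ ≤
      100 * (1 + Real.log X) ^ 3 * (X / √Z) + X / Z := by
    set Ms := (Q.divisors.filter (fun d : ℕ => ¬ (d : ℝ) < Z)).filter
      (fun d : ℕ => (d : ℝ) ≤ D) with hMs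
    have hmem {d : ℕ} (hd : d ∈ Ms) : 0 < d ∧ Z ≤ d ∧ (d : ℝ) ≤ D := by
      rw [hMs, Finset.mem_filter, Finset.mem_filter, not_lt] at hd
      exact ⟨Nat.pos_of_mem_divisors hd.1.1, hd.1.2, hd.2⟩
    have h3 : ∀ d ∈ Ms, ‖T d‖ ≤
        ‖∑ k ∈ (quotientSet S d).filter (fun k : ℕ => Z ≤ k), 1 * expi (β * d * k)‖ + Z := by
      intro d hd
      obtain ⟨hd0, hd1, hd2⟩ := hmem hd
      rw [hT]
      simp only
      rw [← Finset.sum_filter_add_sum_filter_not (quotientSet S d) (fun k : ℕ => Z ≤ k)]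
      simp only [one_mul]
      refine (norm_add_le _ _).trans (add_le_add le_rfl ?_)
      refine (norm_sum_le _ _).trans ?_
      simp only [norm_expi, Finset.sum_const, nsmul_eq_mul, mul_one]
      have : (quotientSet S d).filter (fun k : ℕ => ¬ Z ≤ k) ⊆ Finset.Icc 1 ⌊Z⌋₊ := by
        intro k hk
        obtain ⟨hk1, hk2⟩ := Finset.mem_filter.mp hk
        exact Finset.mem_Icc.mpr ⟨(hquot hd0 hk1).1, Nat.le_floor (not_le.mp hk2).le⟩
      have := Finset.card_le_card this
      rw [Nat.card_Icc, Nat.add_sub_cancel] at this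
      exact (Nat.cast_le.mpr this).trans (Nat.floor_le hZ0.le)
    refine (Finset.sum_le_sum h3).trans ?_
    rw [Finset.sum_add_distrib]
    refine add_le_add ?_ ?_
    · refine bilinear_le hZ hq (by linarith) (by nlinarith) (b := fun _ => 1) (by simp)
        (fun d hd => (hmem hd).2.1) ?_ ?_
      · intro d
        have : (((quotientSet S d).filter (fun k : ℕ => Z ≤ k) : Finset ℕ) : Set ℕ) =
            (quotientSet S d : Set ℕ) ∩ {k : ℕ | Z ≤ k} := by
          ext k; simp
        rw [this]
        refine (ordConnected_quotientSet hS d).inter ⟨fun a ha b _ k hk => ?_⟩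
        have h4 : (a : ℝ) ≤ k := by exact_mod_cast hk.1
        exact le_trans ha h4
      · intro d hd k hk
        obtain ⟨hk1, hk2⟩ := Finset.mem_filter.mp hk
        exact ⟨hk2, (hquot (hmem hd).1 hk1).2⟩
    · rw [Finset.sum_const, nsmul_eq_mul]
      have : Ms ⊆ Finset.Icc 1 ⌊D⌋₊ := by
        intro d hd
        exact Finset.mem_Icc.mpr ⟨(hmem hd).1, Nat.le_floor (hmem hd).2.2⟩
      have := Finset.card_le_card this
      rw [Nat.card_Icc, Nat.add_sub_cancel] at this
      have h4 : (Ms.card : ℝ) ≤ D :=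
        (Nat.cast_le.mpr this).trans (Nat.floor_le (by positivity))
      calc (Ms.card : ℝ) * Z ≤ D * Z := by gcongr
        _ = X / Z := by rw [hD]; field_simp
  -- Large divisors: the trivial bound `X / d`. Divisors of `Q` have only prime factors below `Z`,
  -- so the total is controlled by the smooth tail.
  have hlarge : ∑ d ∈ (Q.divisors.filter (fun d : ℕ => ¬ (d : ℝ) < Z)).filter
      (fun d : ℕ => ¬ (d : ℝ) ≤ D), ‖T d‖ ≤ X * smoothTail Z D X := by
    have h3 : ∀ d ∈ (Q.divisors.filter (fun d : ℕ => ¬ (d : ℝ) < Z)).filter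
        (fun d : ℕ => ¬ (d : ℝ) ≤ D), ‖T d‖ ≤ if (d : ℝ) ≤ X then X * (1 / d) else 0 := by
      intro d hd
      rw [Finset.mem_filter, Finset.mem_filter] at hd
      have hd0 := Nat.pos_of_mem_divisors hd.1.1
      have hd0' : (0 : ℝ) < d := by exact_mod_cast hd0
      have hsub : quotientSet S d ⊆ Finset.Icc 1 ⌊X / d⌋₊ := by
        intro k hk
        obtain ⟨h4, h5⟩ := hquot hd0 hk
        refine Finset.mem_Icc.mpr ⟨h4, Nat.le_floor ?_⟩
        rw [le_div_iff₀ hd0']; linarith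
      have hcard := Finset.card_le_card hsub
      rw [Nat.card_Icc, Nat.add_sub_cancel] at hcard
      have h4 : ‖T d‖ ≤ ((quotientSet S d).card : ℝ) := by
        refine (norm_sum_le _ _).trans ?_
        simp [norm_expi]
      split_ifs with hdX
      · rw [mul_one_div]
        exact h4.trans ((Nat.cast_le.mpr hcard).trans (Nat.floor_le (by positivity)))
      · have : ⌊X / d⌋₊ = 0 := by
          rw [Nat.floor_eq_zero, div_lt_one hd0']
          exact not_le.mp hdX
        rw [this] at hcard
        have : (quotientSet S d).card = 0 := by omega
        rw [this] at h4
        simpa using h4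
    refine (Finset.sum_le_sum h3).trans ?_
    rw [← Finset.sum_filter, ← Finset.mul_sum, smoothTail]
    refine mul_le_mul_of_nonneg_left ?_ (by linarith)
    refine Finset.sum_le_sum_of_subset_of_nonneg ?_ fun _ _ _ => by positivity
    intro d hd
    simp only [Finset.mem_filter, not_le, Nat.mem_smoothNumbersUpTo] at hd ⊢
    exact ⟨⟨Nat.le_floor hd.2, mem_smoothNumbers_of_dvd_primeProd
      (Nat.dvd_of_mem_divisors hd.1.1.1)⟩, hd.1.2⟩
  linarith

lemma Nat.minFac_mul_of_le_minFac {m p : ℕ} (hp : p.Prime) (h : p ≤ m.minFac) :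
    (m * p).minFac = p := by
  apply le_antisymm
  · exact Nat.minFac_le_of_dvd hp.two_le (Dvd.intro_left _ rfl)
  · have hne : m * p ≠ 1 := by
      intro h1
      exact hp.one_lt.ne' (Nat.eq_one_of_mul_eq_one_left h1)
    have hpr := Nat.minFac_prime hne
    rcases (hpr.dvd_mul).mp (Nat.minFac_dvd (m * p)) with h1 | h1
    · exact h.trans (Nat.minFac_le_of_dvd hpr.two_le h1)
    · exact ((Nat.prime_dvd_prime_iff_eq hpr hp).mp h1).ge

/-- An estimate for exponential sums over the primes in an interval. -/
lemma norm_sum_prime_le {X Z β : ℝ} {q : ℚ} (hZ : 2 ≤ Z)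
    (hq : |β - q| ≤ 1 / (q.den : ℝ) ^ 2) (hZr : 2 * Z ≤ q.den) (hrX : q.den * Z ^ 2 ≤ X)
    {S : Finset ℕ} (hS : (S : Set ℕ).OrdConnected) (hSX : ∀ n ∈ S, Z ≤ n ∧ (n : ℝ) ≤ X) :
    ‖∑ n ∈ S with n.Prime, expi (β * n)‖ ≤
      203 * (1 + Real.log X) ^ 3 * (X / √Z) + X * smoothTail Z (X / Z ^ 2) X := by
  have hX : 1 ≤ X := by nlinarith
  have hZ0 : 0 < Z := by linarith
  set Q := primeProd Z with hQ
  have hS1 : ∀ n ∈ S, 1 ≤ n ∧ (n : ℝ) ≤ X := by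
    intro n hn
    obtain ⟨h1, h2⟩ := hSX n hn
    have : (1 : ℝ) ≤ n := by linarith
    exact ⟨by exact_mod_cast this, h2⟩
  have hrough := norm_sum_rough_le (by linarith) hq hZr hrX hS hS1
  set Ms := (Finset.Icc 2 ⌊X⌋₊).filter fun m => m.Coprime Q with hMs
  -- A composite without prime factors below `Z` is uniquely `m p` with `p` its least prime factor.
  -- For fixed `m`, the conditions `p ≤ m.minFac` and `m * p ∈ S` cut out an interval, as the
  -- bilinear estimate requires.
  let S' : ℕ → Finset ℕ := fun m => (Finset.range (⌊X⌋₊ + 1)).filter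
    fun p => Z ≤ (p : ℝ) ∧ p ≤ m.minFac ∧ m * p ∈ S
  let b : ℕ → ℂ := fun p => if p.Prime then 1 else 0
  have hMsZ : ∀ m ∈ Ms, Z ≤ m := by
    intro m hm
    rw [hMs, Finset.mem_filter, Finset.mem_Icc, coprime_primeProd_iff] at hm
    have h1 := hm.2 m.minFac (Nat.minFac_prime (by omega)) (Nat.minFac_dvd m)
    have h2 : (m.minFac : ℝ) ≤ m := by exact_mod_cast Nat.minFac_le (by omega)
    linarith
  have hbil : ∑ m ∈ Ms, ‖∑ p ∈ S' m, b p * expi (β * m * p)‖ ≤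
      100 * (1 + Real.log X) ^ 3 * (X / √Z) := by
    refine bilinear_le (by linarith) hq (by linarith) (by nlinarith) ?_ hMsZ ?_ ?_
    · intro p
      simp only [b]
      split_ifs <;> simp
    · intro m
      constructor
      intro a ha c hc k hk
      simp only [S', Finset.coe_filter, Finset.mem_range, Set.mem_ofPred_eq] at ha hc ⊢
      have h4 : (a : ℝ) ≤ k := by exact_mod_cast hk.1
      exact ⟨by have := hk.2; omega, by linarith, hk.2.trans hc.2.2.1,
        hS.out ha.2.2.2 hc.2.2.2 ⟨Nat.mul_le_mul_left _ hk.1, Nat.mul_le_mul_left _ hk.2⟩⟩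
    · intro m _ p hp
      have hp := (Finset.mem_filter.mp hp).2
      refine ⟨hp.1, ?_⟩
      have := (hSX _ hp.2.2).2
      exact_mod_cast this
  have hcomp : ∑ n ∈ (S.filter fun n => n.Coprime Q) with ¬ n.Prime, expi (β * n) =
      ∑ m ∈ Ms, ∑ p ∈ S' m, b p * expi (β * m * p) := by
    have h1 : ∀ m ∈ Ms, ∑ p ∈ S' m, b p * expi (β * m * p) =
        ∑ p ∈ (S' m).filter Nat.Prime, expi (β * m * p) := by
      intro m _
      rw [Finset.sum_filter Nat.Prime]
      refine Finset.sum_congr rfl fun p _ => ?_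
      simp only [b]
      split_ifs <;> simp
    rw [Finset.sum_congr rfl h1, Finset.sum_sigma']
    refine Finset.sum_bij' (fun n _ => ⟨n / n.minFac, n.minFac⟩) (fun y _ => y.1 * y.2)
      ?_ ?_ ?_ ?_ ?_
    · intro n hn
      simp only [Finset.mem_filter, coprime_primeProd_iff, hQ] at hn
      obtain ⟨⟨hnS, hnQ⟩, hnp⟩ := hn
      obtain ⟨hnZ, hnX⟩ := hSX n hnS
      have hn2 : 2 ≤ n := by
        have : (2 : ℝ) ≤ n := by linarith
        exact_mod_cast this
      have hpr := Nat.minFac_prime (show n ≠ 1 by omega)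
      have hmul : n / n.minFac * n.minFac = n := Nat.div_mul_cancel (Nat.minFac_dvd n)
      have hm1 : n / n.minFac ≠ 1 := by
        intro h
        rw [h, one_mul] at hmul
        exact hnp (hmul ▸ hpr)
      have hm0 : n / n.minFac ≠ 0 := by
        intro h
        rw [h, zero_mul] at hmul
        omega
      have hdvd : n / n.minFac ∣ n := Nat.div_dvd_of_dvd (Nat.minFac_dvd n)
      have hle : n ≤ ⌊X⌋₊ := Nat.le_floor hnX
      simp only [Finset.mem_sigma, Finset.mem_filter, hMs, Finset.mem_Icc, S', Finset.mem_range,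
        coprime_primeProd_iff, hQ]
      refine ⟨⟨⟨(Nat.two_le_iff _).mpr ⟨hm0, hm1⟩, (Nat.div_le_self _ _).trans hle⟩,
        fun p hp hpn => hnQ p hp (hpn.trans hdvd)⟩, ⟨?_, hnQ _ hpr (Nat.minFac_dvd n), ?_, ?_⟩, hpr⟩
      · have := Nat.minFac_le (show 0 < n by omega)
        omega
      · exact Nat.minFac_le_of_dvd (Nat.minFac_prime hm1).two_le
          ((Nat.minFac_dvd _).trans hdvd)
      · rw [hmul]; exact hnS
    · rintro ⟨m, p⟩ hy
      simp only [Finset.mem_sigma, Finset.mem_filter, hMs, Finset.mem_Icc, S', Finset.mem_range,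
        coprime_primeProd_iff, hQ] at hy ⊢
      obtain ⟨⟨⟨hm2, _⟩, hmQ⟩, ⟨_, hpZ, _, hS⟩, hp⟩ := hy
      refine ⟨⟨hS, fun l hl hlm => ?_⟩, Nat.not_prime_mul (by omega) hp.one_lt.ne'⟩
      rcases hl.dvd_mul.mp hlm with h | h
      · exact hmQ l hl h
      · rw [(Nat.prime_dvd_prime_iff_eq hl hp).mp h]; exact hpZ
    · intro n _
      exact Nat.div_mul_cancel (Nat.minFac_dvd n)
    · rintro ⟨m, p⟩ hy
      simp only [Finset.mem_sigma, Finset.mem_filter, S'] at hy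
      have hp := hy.2.2
      have h := Nat.minFac_mul_of_le_minFac hp hy.2.1.2.2.1
      simp only [h, Nat.mul_div_cancel _ hp.pos]
    · intro n _
      have hmul : n / n.minFac * n.minFac = n := Nat.div_mul_cancel (Nat.minFac_dvd n)
      rw [mul_assoc, ← Nat.cast_mul, hmul]
  have hprime : S.filter Nat.Prime = (S.filter fun n => n.Coprime Q).filter Nat.Prime := by
    ext n
    simp only [Finset.mem_filter, coprime_primeProd_iff, hQ]
    constructor
    · rintro ⟨h1, h2⟩
      refine ⟨⟨h1, fun p hp hpn => ?_⟩, h2⟩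
      rw [(Nat.prime_dvd_prime_iff_eq hp h2).mp hpn]
      exact (hSX n h1).1
    · rintro ⟨⟨h1, _⟩, h2⟩
      exact ⟨h1, h2⟩
  have hsplit := Finset.sum_filter_add_sum_filter_not (S.filter fun n => n.Coprime Q) Nat.Prime
    (fun n => expi (β * n))
  rw [hcomp, ← hprime] at hsplit
  have hfin : ‖∑ n ∈ S with n.Prime, expi (β * n)‖ ≤
      ‖∑ n ∈ S with n.Coprime Q, expi (β * n)‖ +
        ∑ m ∈ Ms, ‖∑ p ∈ S' m, b p * expi (β * m * p)‖ := by
    rw [eq_sub_of_add_eq hsplit]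
    exact (norm_sub_le _ _).trans (add_le_add le_rfl (norm_sum_le _ _))
  have hZs : X / Z ≤ (1 + Real.log X) ^ 3 * (X / √Z) := by
    have h1 : √Z ≤ Z := by
      rw [Real.sqrt_le_left hZ0.le]; nlinarith
    have h2 : X / Z ≤ X / √Z := by gcongr
    have h3 := Real.log_nonneg hX
    have h4 : 1 ≤ (1 + Real.log X) ^ 3 := one_le_pow₀ (by linarith)
    have h5 : 0 ≤ X / √Z := by positivity
    nlinarith
  linarith

/-! ### Reciprocals of primes and Rankin's method for smooth numbers. -/

/-- A crude form of Mertens' upper bound: by Chebyshev's bound on `θ`, the primes between `2 ^ (K +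
1)` and `2 ^ (K + 2)` contribute at most `4 / (K + 1)`. -/
lemma sum_primesBelow_two_pow_le (K : ℕ) :
    ∑ p ∈ Nat.primesBelow (2 ^ (K + 1)), 1 / (p : ℝ) ≤ 4 * (harmonic K : ℝ) := by
  induction K with
  | zero => simp [Nat.primesBelow, Finset.sum_filter, Finset.sum_range_succ, Nat.not_prime_zero,
      Nat.not_prime_one]
  | succ K ih =>
    have hsub : Nat.primesBelow (2 ^ (K + 1)) ⊆ Nat.primesBelow (2 ^ (K + 1 + 1)) := by
      intro p hp
      rw [Nat.mem_primesBelow] at hp ⊢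
      exact ⟨hp.1.trans (Nat.pow_lt_pow_right one_lt_two (by omega)), hp.2⟩
    rw [← Finset.sum_sdiff hsub, harmonic_succ]
    have hlog2 : 0 < Real.log 2 := Real.log_pos one_lt_two
    have hK : (0 : ℝ) < K + 1 := by positivity
    have h1 : ∑ p ∈ Nat.primesBelow (2 ^ (K + 1 + 1)) \ Nat.primesBelow (2 ^ (K + 1)), 1 / (p : ℝ) ≤
        4 / (K + 1) := by
      have h2 : ∀ p ∈ Nat.primesBelow (2 ^ (K + 1 + 1)) \ Nat.primesBelow (2 ^ (K + 1)),
          1 / (p : ℝ) ≤ Real.log p * (1 / (2 ^ (K + 1) * ((K + 1) * Real.log 2))) := by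
        intro p hp
        rw [Finset.mem_sdiff, Nat.mem_primesBelow, Nat.mem_primesBelow] at hp
        obtain ⟨⟨_, hpr⟩, h3⟩ := hp
        have h4 : 2 ^ (K + 1) ≤ p := by
          by_contra h; exact h3 ⟨not_le.mp h, hpr⟩
        have h5 : (2 : ℝ) ^ (K + 1) ≤ p := by exact_mod_cast h4
        have h6 := Real.log_le_log (by positivity) h5
        rw [Real.log_pow] at h6
        push_cast at h6
        rw [mul_one_div, div_le_div_iff₀ (by linarith [pow_pos (two_pos (α := ℝ)) (K + 1)])
          (by positivity)]
        have : 0 ≤ (K + 1) * Real.log 2 := by positivity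
        nlinarith
      refine (Finset.sum_le_sum h2).trans ?_
      rw [← Finset.sum_mul, mul_one_div, div_le_div_iff₀ (by positivity) hK]
      have h7 : ∑ p ∈ Nat.primesBelow (2 ^ (K + 1 + 1)) \ Nat.primesBelow (2 ^ (K + 1)),
          Real.log p ≤ Chebyshev.theta ((2 ^ (K + 1 + 1) : ℕ) : ℝ) := by
        rw [Chebyshev.theta_eq_sum_primesLE_log]
        refine Finset.sum_le_sum_of_subset_of_nonneg ?_ fun p _ _ => Real.log_natCast_nonneg p
        intro p hp
        rw [Finset.mem_sdiff, Nat.mem_primesBelow] at hp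
        rw [Nat.mem_primesLE]
        exact ⟨hp.1.1.le, hp.1.2⟩
      have h8 := Chebyshev.theta_le_log4_mul_x (x := ((2 ^ (K + 1 + 1) : ℕ) : ℝ)) (by positivity)
      have h9 : Real.log 4 = 2 * Real.log 2 := by
        rw [show (4 : ℝ) = 2 ^ 2 by norm_num, Real.log_pow]; norm_num
      rw [h9] at h8
      push_cast at h8 h7
      calc _ ≤ (2 * Real.log 2 * 2 ^ (K + 1 + 1)) * ((K : ℝ) + 1) := by
            gcongr; exact h7.trans h8
        _ = _ := by ring
    push_cast
    rw [div_eq_mul_inv] at h1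
    linarith

lemma sum_primesBelow_exp_le {L : ℝ} (hL : 0 < L) :
    ∑ p ∈ Nat.primesBelow ⌈Real.exp L⌉₊, 1 / (p : ℝ) ≤ 4 * (1 + Real.log (2 * L + 1)) := by
  -- Since `log 2 > 1/2`, this `K` makes `2 ^ (K + 1)` at least `exp L`.
  set K := ⌈2 * L⌉₊ with hK
  have hK1 : 0 < K := Nat.ceil_pos.mpr (by linarith)
  have hKle : (K : ℝ) ≤ 2 * L + 1 := (Nat.ceil_lt_add_one (by linarith)).le
  have hpow : Real.exp L ≤ 2 ^ (K + 1) := by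
    rw [← Real.le_log_iff_exp_le (by positivity), Real.log_pow]
    have h1 := Real.log_two_gt_d9
    have h2 : 2 * L ≤ K := Nat.le_ceil _
    push_cast
    nlinarith
  have hsub : Nat.primesBelow ⌈Real.exp L⌉₊ ⊆ Nat.primesBelow (2 ^ (K + 1)) := by
    intro p hp
    rw [Nat.mem_primesBelow] at hp ⊢
    refine ⟨hp.1.trans_le (Nat.ceil_le.mpr ?_), hp.2⟩
    exact_mod_cast hpow
  calc _ ≤ ∑ p ∈ Nat.primesBelow (2 ^ (K + 1)), 1 / (p : ℝ) :=
        Finset.sum_le_sum_of_subset_of_nonneg hsub fun _ _ _ => by positivity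
    _ ≤ 4 * (harmonic K : ℝ) := sum_primesBelow_two_pow_le K
    _ ≤ 4 * (1 + Real.log K) := by gcongr; exact harmonic_le_one_add_log K
    _ ≤ _ := by gcongr

/-- The completely multiplicative function `n ↦ n ^ (-σ)`. -/
noncomputable def rpowNegHom (σ : ℝ) : ℕ →* ℝ where
  toFun n := (n : ℝ) ^ (-σ)
  map_one' := by simp
  map_mul' m n := by
    rw [Nat.cast_mul, Real.mul_rpow (Nat.cast_nonneg _) (Nat.cast_nonneg _)]

lemma inv_one_sub_le_exp {t : ℝ} (h0 : 0 ≤ t) (h1 : t ≤ 3 / 5) :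
    (1 - t)⁻¹ ≤ Real.exp (5 / 2 * t) := by
  have h2 : 0 < 1 - t := by linarith
  have h3 : (1 - t)⁻¹ = t / (1 - t) + 1 := by field_simp; ring
  rw [h3]
  refine (Real.add_one_le_exp _).trans (Real.exp_le_exp.mpr ?_)
  rw [div_le_iff₀ h2]
  nlinarith

lemma prime_rpow_neg_le {p : ℕ} (hp : p.Prime) {η : ℝ} (hη : η ≤ 1 / 4) :
    (p : ℝ) ^ (-(1 - η)) ≤ 3 / 5 := by
  have h2 : (2 : ℝ) ≤ p := by exact_mod_cast hp.two_le
  calc (p : ℝ) ^ (-(1 - η)) ≤ (2 : ℝ) ^ (-(1 - η)) :=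
        Real.rpow_le_rpow_of_nonpos two_pos h2 (by linarith)
    _ ≤ (2 : ℝ) ^ (-(3 / 4) : ℝ) := Real.rpow_le_rpow_of_exponent_le one_le_two (by linarith)
    _ ≤ 3 / 5 := by
        have h3 : ((2 : ℝ) ^ (-(3 / 4) : ℝ)) ^ 4 = 1 / 8 := by
          rw [← Real.rpow_natCast, ← Real.rpow_mul two_pos.le]
          norm_num
        have h4 : (0 : ℝ) < (2 : ℝ) ^ (-(3 / 4) : ℝ) := by positivity
        refine le_of_pow_le_pow_left₀ (n := 4) (by norm_num) (by norm_num) ?_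
        rw [h3]; norm_num

/-- Bound the partial sum by the Euler product over primes below `Z`. Each factor is at most `exp
(5/2 * p ^ (-(1 - η)))`, because `p ^ (-(1 - η)) ≤ 3/5`, and `p ^ η ≤ Z ^ η`. -/
lemma sum_smooth_rpow_le {Z η : ℝ} (hη0 : 0 ≤ η) (hη : η ≤ 1 / 4) {s : Finset ℕ}
    (hs : ∀ n ∈ s, n ∈ Nat.smoothNumbers ⌈Z⌉₊) :
    ∑ n ∈ s, (n : ℝ) ^ (-(1 - η)) ≤
      Real.exp (5 / 2 * Z ^ η * ∑ p ∈ Nat.primesBelow ⌈Z⌉₊, 1 / (p : ℝ)) := by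
  have hlt {p : ℕ} (hp : p.Prime) : ‖rpowNegHom (1 - η) p‖ < 1 := by
    have h1 : (0 : ℝ) ≤ (p : ℝ) ^ (-(1 - η)) := by positivity
    have h2 := prime_rpow_neg_le hp hη
    change ‖(p : ℝ) ^ (-(1 - η))‖ < 1
    rw [Real.norm_of_nonneg h1]
    linarith
  have hsum := (EulerProduct.summable_and_hasSum_smoothNumbers_prod_primesBelow_geometric
    (f := rpowNegHom (1 - η)) hlt ⌈Z⌉₊).2
  have h1 := sum_le_hasSum (s.subtype (· ∈ Nat.smoothNumbers ⌈Z⌉₊))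
    (fun m _ => by change (0 : ℝ) ≤ ((m : ℕ) : ℝ) ^ (-(1 - η)); positivity) hsum
  rw [Finset.sum_subtype_of_mem (fun n => rpowNegHom (1 - η) n) hs] at h1
  refine h1.trans ?_
  rw [Finset.mul_sum, Real.exp_sum]
  refine Finset.prod_le_prod ?_ ?_
  · intro p hp
    have := hlt (Nat.prime_of_mem_primesBelow hp)
    rw [Real.norm_eq_abs, abs_lt] at this
    exact inv_nonneg.mpr (by linarith)
  · intro p hp
    have hpr := Nat.prime_of_mem_primesBelow hp
    have hpZ : (p : ℝ) ≤ Z := (Nat.lt_ceil.mp (Nat.lt_of_mem_primesBelow hp)).le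
    have hp0 : (0 : ℝ) < p := by exact_mod_cast hpr.pos
    change (1 - (p : ℝ) ^ (-(1 - η)))⁻¹ ≤ _
    refine (inv_one_sub_le_exp (by positivity) (prime_rpow_neg_le hpr hη)).trans ?_
    rw [Real.exp_le_exp, mul_assoc]
    refine mul_le_mul_of_nonneg_left ?_ (by norm_num)
    rw [neg_sub, Real.rpow_sub hp0, Real.rpow_one, mul_one_div]
    gcongr

/-- Rankin's trick: insert the factor `(d / D) ^ η ≥ 1`. -/
lemma smoothTail_le_rankin {Z D X η : ℝ} (hD : 0 < D) (hη0 : 0 ≤ η) (hη : η ≤ 1 / 4) :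
    smoothTail Z D X ≤ D ^ (-η) *
      Real.exp (5 / 2 * Z ^ η * ∑ p ∈ Nat.primesBelow ⌈Z⌉₊, 1 / (p : ℝ)) := by
  refine le_trans ?_ (mul_le_mul_of_nonneg_left (sum_smooth_rpow_le hη0 hη
    (s := (Nat.smoothNumbersUpTo ⌊X⌋₊ ⌈Z⌉₊).filter (fun d : ℕ => D < d)) ?_) (by positivity))
  · rw [Finset.mul_sum, smoothTail]
    refine Finset.sum_le_sum fun d hd => ?_
    have hDd := (Finset.mem_filter.mp hd).2
    have hd0 : (0 : ℝ) < d := hD.trans hDd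
    have h1 : 1 / (d : ℝ) = (d : ℝ) ^ (-η) * (d : ℝ) ^ (-(1 - η)) := by
      rw [← Real.rpow_add hd0, one_div, ← Real.rpow_neg_one]
      congr 1; ring
    rw [h1]
    exact mul_le_mul_of_nonneg_right
      (Real.rpow_le_rpow_of_nonpos hD hDd.le (by linarith)) (by positivity)
  · intro d hd
    exact (Nat.mem_smoothNumbersUpTo.mp (Finset.mem_filter.mp hd).1).2

/-- Rankin's trick again, with the factor `(x / d) ^ (1 - η) ≥ 1`. -/
lemma card_smoothNumbersUpTo_le_rankin {Z x η : ℝ} (hx : 1 ≤ x) (hη0 : 0 ≤ η) (hη : η ≤ 1 / 4) :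
    ((Nat.smoothNumbersUpTo ⌊x⌋₊ ⌈Z⌉₊).card : ℝ) ≤ x * x ^ (-η) *
      Real.exp (5 / 2 * Z ^ η * ∑ p ∈ Nat.primesBelow ⌈Z⌉₊, 1 / (p : ℝ)) := by
  have hx0 : 0 < x := by linarith
  refine le_trans ?_ (mul_le_mul_of_nonneg_left (sum_smooth_rpow_le hη0 hη
    (s := Nat.smoothNumbersUpTo ⌊x⌋₊ ⌈Z⌉₊)
    fun d hd => (Nat.mem_smoothNumbersUpTo.mp hd).2) (by positivity))
  rw [Finset.mul_sum, Finset.card_eq_sum_ones]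
  push_cast
  refine Finset.sum_le_sum fun d hd => ?_
  obtain ⟨h1, h2⟩ := Nat.mem_smoothNumbersUpTo.mp hd
  have hd0 : (0 : ℝ) < d := by exact_mod_cast Nat.pos_of_ne_zero (Nat.ne_zero_of_mem_smoothNumbers h2)
  have hdx : (d : ℝ) ≤ x := (Nat.le_floor_iff hx0.le).mp h1
  have h3 : x * x ^ (-η) = x ^ (1 - η) := by
    rw [sub_eq_add_neg, Real.rpow_add hx0, Real.rpow_one]
  rw [h3, Real.rpow_neg hd0.le, ← div_eq_mul_inv, le_div_iff₀ (by positivity), one_mul]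
  exact Real.rpow_le_rpow hd0.le hdx (by linarith)

/-! ### Asymptotics of the error exponent and the choice of Rankin's parameter. -/

/-- The function `√(log x log log x)` governing the size of the error terms. -/
noncomputable def errorExponent (x : ℝ) : ℝ := √(Real.log x * Real.log (Real.log x))

lemma eventually_sqrt_log_le_errorExponent :
    ∀ᶠ x : ℝ in atTop, √(Real.log x) ≤ errorExponent x ∧ errorExponent x ≤ Real.log x ∧
      errorExponent x ^ 2 = Real.log x * Real.log (Real.log x) := by
  filter_upwards [Real.tendsto_log_atTop.eventually_ge_atTop (Real.exp 1)] with x hx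
  set u := Real.log x
  have hu0 : 0 < u := (Real.exp_pos 1).trans_le hx
  have h1 : 1 ≤ Real.log u := (Real.le_log_iff_exp_le hu0).mpr hx
  have h2 : Real.log u ≤ u := (Real.log_le_sub_one_of_pos hu0).trans (by linarith)
  refine ⟨Real.sqrt_le_sqrt (by nlinarith), ?_, Real.sq_sqrt (by positivity)⟩
  rw [errorExponent, Real.sqrt_le_left hu0.le]
  nlinarith

lemma eventually_mul_log_le_errorExponent (c ε : ℝ) (hε : 0 < ε) :
    ∀ᶠ x : ℝ in atTop, c * Real.log (Real.log x) ≤ ε * errorExponent x := by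
  have h1 : (fun u : ℝ => c * Real.log u) =o[atTop] fun u => u ^ (1 / 2 : ℝ) :=
    (isLittleO_log_rpow_atTop (by norm_num)).const_mul_left c
  have h2 := Real.tendsto_log_atTop.eventually (h1.bound hε)
  filter_upwards [h2, eventually_sqrt_log_le_errorExponent,
    Real.tendsto_log_atTop.eventually_ge_atTop 0] with x hx hL hu
  rw [← Real.sqrt_eq_rpow, Real.norm_of_nonneg (Real.sqrt_nonneg _)] at hx
  exact (le_abs_self _).trans (hx.trans (by gcongr; exact hL.1))

/-- The left side will bound the exponent of the Euler product. As `0.46 < 1/2`, a power `(log x) ^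
0.04` remains to absorb the iterated logarithm, and `√(log x) ≤ errorExponent x`. -/
lemma eventually_euler_factor_le :
    ∀ᶠ x : ℝ in atTop, 10 * Real.log x ^ (0.46 : ℝ) * (1 + Real.log (2 * errorExponent x + 1)) ≤
      0.01 * errorExponent x := by
  have h1 : (fun u : ℝ => 10 * (1 + Real.log (2 * u + 1))) =o[atTop] fun u => u ^ (0.04 : ℝ) := by
    have h2 : (fun u : ℝ => 1 + Real.log (2 * u + 1)) =O[atTop] Real.log := by
      apply IsBigO.of_bound 4
      filter_upwards [eventually_ge_atTop 3] with u hu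
      have h3 : 1 ≤ Real.log u :=
        (Real.le_log_iff_exp_le (by linarith)).mpr (by linarith [Real.exp_one_lt_d9])
      have h4 : Real.log (2 * u + 1) ≤ 2 * Real.log u := by
        rw [← Real.log_rpow (by linarith)]
        apply Real.log_le_log (by linarith)
        norm_num; nlinarith
      have h5 : 0 ≤ Real.log (2 * u + 1) := Real.log_nonneg (by linarith)
      rw [Real.norm_of_nonneg (by linarith), Real.norm_of_nonneg (by linarith)]
      linarith
    exact (h2.const_mul_left 10).trans_isLittleO (isLittleO_log_rpow_atTop (by norm_num))
  have h2 := Real.tendsto_log_atTop.eventually (h1.bound (show (0 : ℝ) < 0.01 by norm_num))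
  filter_upwards [h2, eventually_sqrt_log_le_errorExponent,
    Real.tendsto_log_atTop.eventually_ge_atTop 1] with x hx hL hu
  set u := Real.log x
  have hu0 : 0 < u := by linarith
  rw [Real.norm_of_nonneg (by positivity : (0 : ℝ) ≤ u ^ (0.04 : ℝ))] at hx
  have h3 := (le_abs_self _).trans hx
  have hE0 : 0 ≤ errorExponent x := Real.sqrt_nonneg _
  calc 10 * u ^ (0.46 : ℝ) * (1 + Real.log (2 * errorExponent x + 1))
      ≤ 10 * u ^ (0.46 : ℝ) * (1 + Real.log (2 * u + 1)) := by
        gcongr; exact hL.2.1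
    _ = u ^ (0.46 : ℝ) * (10 * (1 + Real.log (2 * u + 1))) := by ring
    _ ≤ u ^ (0.46 : ℝ) * (0.01 * u ^ (0.04 : ℝ)) := by gcongr
    _ = 0.01 * √u := by
        rw [Real.sqrt_eq_rpow, mul_left_comm, ← Real.rpow_add hu0]; norm_num
    _ ≤ _ := by gcongr; exact hL.1

lemma eventually_smooth_le :
    ∀ᶠ x : ℝ in atTop,
      ((Nat.smoothNumbersUpTo ⌊x⌋₊ ⌈Real.exp (errorExponent x)⌉₊).card : ℝ) ≤
        x * Real.exp (-0.44 * errorExponent x) ∧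
      ∀ X : ℝ, x / Real.exp (errorExponent x) ≤ X →
        smoothTail (Real.exp (errorExponent x)) (X / Real.exp (errorExponent x) ^ 2) X ≤
          Real.exp (-0.44 * errorExponent x) := by
  filter_upwards [eventually_euler_factor_le, eventually_sqrt_log_le_errorExponent,
    eventually_mul_log_le_errorExponent 1.38 0.01 (by norm_num),
    Real.tendsto_log_atTop.eventually_ge_atTop (Real.exp 1), eventually_ge_atTop 1]
    with x hF hL hlog hu hx
  set L := errorExponent x with hLdef
  set u := Real.log x with hudef
  have hx0 : 0 < x := by linarith
  have hu0 : 0 < u := (Real.exp_pos 1).trans_le hu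
  have hlu : 1 ≤ Real.log u := (Real.le_log_iff_exp_le hu0).mpr hu
  have hL0 : 0 < L := (Real.sqrt_pos.mpr hu0).trans_le hL.1
  -- Since `L ^ 2 = log x * log (log x)`, this choice gives `x ^ (-η) = exp (-0.46 L)` and `Z ^ η =
  -- (log x) ^ 0.46`. The Euler product costs `exp (0.01 L)`; replacing `x` by `x * exp (-3 L)` in
  -- the tail costs `(log x) ^ 1.38`, again at most `exp (0.01 L)`.
  set η := 0.46 * Real.log u / L with hη
  have hη0 : 0 ≤ η := by positivity
  have hη4 : η ≤ 1 / 4 := by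
    rw [hη, div_le_iff₀ hL0]; linarith
  have hηL : η * L = 0.46 * Real.log u := by rw [hη]; field_simp
  have hηu : η * u = 0.46 * L := by
    rw [hη, div_mul_eq_mul_div, div_eq_iff hL0.ne']
    linear_combination -0.46 * hL.2.2
  have hE : Real.exp (5 / 2 * Real.exp L ^ η *
      ∑ p ∈ Nat.primesBelow ⌈Real.exp L⌉₊, 1 / (p : ℝ)) ≤ Real.exp (0.01 * L) := by
    rw [Real.exp_le_exp]
    have h1 : Real.exp L ^ η = u ^ (0.46 : ℝ) := by
      rw [← Real.exp_mul, Real.rpow_def_of_pos hu0, mul_comm L, hηL, mul_comm]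
    rw [h1]
    calc _ ≤ 5 / 2 * u ^ (0.46 : ℝ) * (4 * (1 + Real.log (2 * L + 1))) := by
          gcongr; exact sum_primesBelow_exp_le hL0
      _ = 10 * u ^ (0.46 : ℝ) * (1 + Real.log (2 * L + 1)) := by ring
      _ ≤ _ := hF
  have hxη : x ^ (-η) = Real.exp (-0.46 * L) := by
    rw [Real.rpow_def_of_pos hx0, ← hudef]
    congr 1
    linear_combination -hηu
  constructor
  · refine (card_smoothNumbersUpTo_le_rankin hx hη0 hη4).trans ?_
    rw [hxη, mul_assoc]
    refine mul_le_mul_of_nonneg_left ?_ hx0.le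
    refine (mul_le_mul_of_nonneg_left hE (Real.exp_pos _).le).trans ?_
    rw [← Real.exp_add, Real.exp_le_exp]
    linarith
  · intro X hX
    have hD : x * Real.exp (-3 * L) ≤ X / Real.exp L ^ 2 := by
      rw [le_div_iff₀ (by positivity)]
      refine le_trans (le_of_eq ?_) hX
      rw [div_eq_mul_inv, ← Real.exp_neg, ← Real.exp_nat_mul, mul_assoc, ← Real.exp_add]
      congr 2; push_cast; ring
    have hD0 : 0 < x * Real.exp (-3 * L) := by positivity
    refine (smoothTail_le_rankin (hD0.trans_le hD) hη0 hη4).trans ?_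
    have h2 : (X / Real.exp L ^ 2) ^ (-η) ≤ Real.exp (-0.46 * L + 1.38 * Real.log u) := by
      refine (Real.rpow_le_rpow_of_nonpos hD0 hD (by linarith)).trans (le_of_eq ?_)
      rw [Real.mul_rpow hx0.le (Real.exp_pos _).le, hxη, ← Real.exp_mul, ← Real.exp_add]
      congr 1
      linear_combination 3 * hηL
    refine (mul_le_mul h2 hE (Real.exp_pos _).le (Real.exp_pos _).le).trans ?_
    rw [← Real.exp_add, Real.exp_le_exp]
    linarith

/-! ### Continued fractions and Diophantine approximation. -/

lemma Irrational.not_terminatedAt {α : ℝ} (hα : Irrational α) (n : ℕ) :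
    ¬ (GenContFract.of α).TerminatedAt n := by
  intro h
  obtain ⟨q, hq⟩ := (GenContFract.terminates_iff_rat α).mp ⟨n, h⟩
  exact hα ⟨q, hq.symm⟩

lemma Irrational.exists_int_eq_nums_dens {α : ℝ} (hα : Irrational α) (n : ℕ) :
    (∃ a : ℤ, (GenContFract.of α).nums n = a) ∧ ∃ b : ℤ, (GenContFract.of α).dens n = b := by
  have hget (k : ℕ) : ∃ gp, (GenContFract.of α).s.get? k = some gp ∧ gp.a = 1 ∧
      ∃ z : ℤ, gp.b = z := by
    obtain ⟨gp, hgp⟩ := Option.ne_none_iff_exists'.mp (hα.not_terminatedAt k)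
    exact ⟨gp, hgp, GenContFract.of_partNum_eq_one_and_exists_int_partDen_eq hgp⟩
  induction n using Nat.twoStepInduction with
  | zero =>
    exact ⟨⟨⌊α⌋, by rw [GenContFract.zeroth_num_eq_h, GenContFract.of_h_eq_floor]⟩,
      ⟨1, by rw [GenContFract.zeroth_den_eq_one, Int.cast_one]⟩⟩
  | one =>
    obtain ⟨gp, hgp, ha, z, hz⟩ := hget 0
    refine ⟨⟨z * ⌊α⌋ + 1, ?_⟩, ⟨z, ?_⟩⟩
    · rw [GenContFract.first_num_eq hgp, ha, hz, GenContFract.of_h_eq_floor]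
      push_cast; ring
    · rw [GenContFract.first_den_eq hgp, hz]
  | more k h0 h1 =>
    obtain ⟨gp, hgp, ha, z, hz⟩ := hget (k + 1)
    obtain ⟨⟨a0, ha0⟩, ⟨b0, hb0⟩⟩ := h0
    obtain ⟨⟨a1, ha1⟩, ⟨b1, hb1⟩⟩ := h1
    refine ⟨⟨z * a1 + a0, ?_⟩, ⟨z * b1 + b0, ?_⟩⟩
    · rw [GenContFract.nums_recurrence hgp ha0 ha1, ha, hz]; push_cast; ring
    · rw [GenContFract.dens_recurrence hgp hb0 hb1, ha, hz]; push_cast; ring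

/-- The determinant identity makes the convergent `p / q` reduced, so `d p / q` stays `1 / q` away
from integers when `d < q / 2`. The error `d |α - p / q|` is at most `1 / (2 q)`. -/
lemma Irrational.one_div_le_abs_mul_sub {α : ℝ} (hα : Irrational α) {d j : ℕ} (hd : 0 < d)
    (hj : 2 * (d : ℝ) < (GenContFract.of α).dens j) (z : ℤ) :
    1 / (2 * (GenContFract.of α).dens j) ≤ |d * α - z| := by
  obtain ⟨⟨p, hp⟩, ⟨q, hq⟩⟩ := hα.exists_int_eq_nums_dens j
  obtain ⟨⟨p', hp'⟩, ⟨q', hq'⟩⟩ := hα.exists_int_eq_nums_dens (j + 1)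
  have hd1 : (1 : ℝ) ≤ d := by exact_mod_cast hd
  have hq0 : (0 : ℝ) < q := by rw [← hq]; linarith
  have hdet : p * q' - q * p' = (-1) ^ (j + 1) := by
    have h := SimpContFract.determinant (s := SimpContFract.of α) (n := j)
      (hα.not_terminatedAt j)
    change (GenContFract.of α).nums j * (GenContFract.of α).dens (j + 1) -
      (GenContFract.of α).dens j * (GenContFract.of α).nums (j + 1) = _ at h
    rw [hp, hq, hp', hq'] at h
    exact_mod_cast h
  have hcop : IsCoprime q p := by
    rcases neg_one_pow_eq_or ℤ (j + 1) with h | h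
    · exact ⟨-p', q', by rw [h] at hdet; linarith⟩
    · exact ⟨p', -q', by rw [h] at hdet; linarith⟩
  have happ := GenContFract.abs_sub_convs_le (hα.not_terminatedAt j)
  have hmono := GenContFract.of_den_mono (v := α) (n := j)
  rw [GenContFract.conv_eq_num_div_den, hp, hq, hq'] at happ
  rw [hq] at hj hmono ⊢
  rw [hq'] at hmono
  have h1 : |α - p / q| ≤ 1 / (q : ℝ) ^ 2 := by
    refine happ.trans ?_
    rw [sq]
    gcongr
  have h2 : d * p - z * q ≠ 0 := by
    intro h
    have h3 : q ∣ (d : ℤ) := hcop.dvd_of_dvd_mul_right ⟨z, by linarith⟩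
    have h4 := Int.le_of_dvd (by exact_mod_cast hd) h3
    have h5 : (q : ℝ) ≤ d := by exact_mod_cast h4
    linarith
  have h3 : (1 : ℝ) ≤ |(d * p - z * q : ℝ)| := by exact_mod_cast Int.one_le_abs h2
  have h4 : |(d * p - z * q : ℝ)| = q * |d * (p / q : ℝ) - z| := by
    rw [← abs_of_pos hq0, ← abs_mul, abs_of_pos hq0]
    congr 1; field_simp
  have h5 : |d * (p / q : ℝ) - z| ≤ |d * α - z| + |d * (α - p / q)| := by
    have := abs_sub (d * α - z) (d * (α - p / q))
    rwa [show d * α - z - d * (α - p / q) = d * (p / q : ℝ) - z by ring] at this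
  have h6 : |d * (α - p / q)| ≤ 1 / (2 * q) := by
    rw [abs_mul, Nat.abs_cast]
    calc d * |α - p / q| ≤ (q / 2) * (1 / (q : ℝ) ^ 2) := by gcongr; linarith
      _ = _ := by field_simp
  have h7 : 1 / (q : ℝ) ≤ |d * (p / q : ℝ) - z| := by
    rw [div_le_iff₀ hq0, mul_comm, ← h4]; exact h3
  have h8 : 1 / (q : ℝ) = 1 / (2 * q) + 1 / (2 * q) := by field_simp; norm_num
  linarith

/-- A real number of finite irrationality measure is Diophantine. -/
lemma exists_diophantine {α : ℝ} (hα : Irrational α) (hfin : irrationalityMeasure α < ⊤) :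
    ∃ (R : ℕ) (c : ℝ), 0 < c ∧ ∀ d : ℕ, 0 < d → ∀ z : ℤ, c ≤ (d : ℝ) ^ R * |d * α - z| := by
  set Q : ℕ → ℝ := (GenContFract.of α).dens with hQ
  have hmono : Monotone Q := monotone_nat_of_le_succ fun n => GenContFract.of_den_mono
  have hfib (n : ℕ) : (Nat.fib (n + 1) : ℝ) ≤ Q n :=
    GenContFract.succ_nth_fib_le_of_nth_den (Or.inr (hα.not_terminatedAt _))
  have htend : Tendsto Q atTop atTop := by
    refine tendsto_atTop_mono' _ ?_ (tendsto_natCast_atTop_atTop (R := ℝ))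
    filter_upwards [eventually_ge_atTop 5] with n hn
    refine le_trans ?_ (hfib n)
    exact_mod_cast (Nat.le_fib_self hn).trans (Nat.fib_mono (Nat.le_succ n))
  have hlim : limsup (fun j : ℕ => ((Real.log (Q (j + 1)) / Real.log (Q j) : ℝ) : EReal)) atTop
      < ⊤ := by
    rw [lt_top_iff_ne_top]
    intro h
    rw [irrationalityMeasure] at hfin
    change (1 : EReal) + limsup (fun j : ℕ =>
      ((Real.log (Q (j + 1)) / Real.log (Q j) : ℝ) : EReal)) atTop < ⊤ at hfin
    rw [h] at hfin
    exact absurd hfin (by simp [show (1 : EReal) + ⊤ = ⊤ from rfl])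
  obtain ⟨R₀, hR₀, -⟩ := EReal.lt_iff_exists_real_btwn.mp hlim
  have hev := eventually_lt_of_limsup_lt hR₀
  obtain ⟨J, hJ⟩ := eventually_atTop.mp (hev.and (htend.eventually_ge_atTop 2))
  set R := ⌈R₀⌉₊ with hR
  have hstep : ∀ j, J ≤ j → Q (j + 1) ≤ Q j ^ R := by
    intro j hj
    obtain ⟨h1, h2⟩ := hJ j hj
    rw [EReal.coe_lt_coe_iff] at h1
    have h3 : 0 < Real.log (Q j) := Real.log_pos (by linarith)
    rw [div_lt_iff₀ h3] at h1
    have h4 : R₀ ≤ R := Nat.le_ceil _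
    have h5 : 0 < Q j := by linarith
    rw [← Real.log_le_log_iff (h5.trans_le (hmono (Nat.le_succ j))) (by positivity), Real.log_pow]
    nlinarith
  have hQ1 (n : ℕ) : 1 ≤ Q n := by
    refine le_trans ?_ (hfib n)
    exact_mod_cast Nat.fib_pos.mpr (Nat.succ_pos n)
  refine ⟨R, 1 / (2 ^ (R + 1) * Q J), by have := hQ1 J; positivity, fun d hd z => ?_⟩
  have hd1 : (1 : ℝ) ≤ d := by exact_mod_cast hd
  have hex : ∃ j, 2 * (d : ℝ) < Q j := (htend.eventually_gt_atTop _).exists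
  classical
  -- The first denominator exceeding `2 d`: its predecessor is at most `2 d`, so beyond index `J`
  -- the growth condition bounds `Q j` by `(2 d) ^ R`. Indices up to `J` are covered by the constant
  -- `Q J`.
  set j := Nat.find hex with hj
  have hjspec : 2 * (d : ℝ) < Q j := Nat.find_spec hex
  have hlow := hα.one_div_le_abs_mul_sub hd hjspec z
  have hpow1 : (1 : ℝ) ≤ (2 * d) ^ R := one_le_pow₀ (by linarith)
  have hup : Q j ≤ (2 * d) ^ R * Q J := by
    rcases le_or_gt j J with h | h
    · have := hmono h
      have := hQ1 J
      nlinarith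
    · obtain ⟨i, hi⟩ : ∃ i, j = i + 1 := ⟨j - 1, by omega⟩
      have h1 : Q i ≤ 2 * d := not_lt.mp (Nat.find_min hex (by omega))
      have h2 := hstep i (by omega)
      rw [hi]
      have h3 : Q i ^ R ≤ (2 * d) ^ R := pow_le_pow_left₀ (by linarith [hQ1 i]) h1 R
      have := hQ1 J
      nlinarith
  have hQj : 0 < Q j := by linarith [hQ1 j]
  have hQJ : 0 < Q J := by linarith [hQ1 J]
  calc 1 / (2 ^ (R + 1) * Q J) = (d : ℝ) ^ R * (1 / (2 * ((2 * d) ^ R * Q J))) := by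
        rw [mul_pow, pow_succ]; field_simp
    _ ≤ (d : ℝ) ^ R * (1 / (2 * Q j)) := by gcongr
    _ ≤ _ := by gcongr

lemma eventually_errorExponent_le (ε : ℝ) (hε : 0 < ε) :
    ∀ᶠ x : ℝ in atTop, errorExponent x ≤ ε * Real.log x := by
  have h2 := Real.tendsto_log_atTop.eventually
    (Real.isLittleO_log_id_atTop.bound (show 0 < ε ^ 2 by positivity))
  filter_upwards [h2, Real.tendsto_log_atTop.eventually_ge_atTop 0] with x hx hu
  rw [id, Real.norm_of_nonneg hu] at hx
  have h3 := (le_abs_self _).trans hx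
  rw [errorExponent, Real.sqrt_le_left (by positivity), mul_pow]
  nlinarith

/-- Rational approximations to the small multiples of a number of finite irrationality measure,
with denominators neither too small nor too large. -/
lemma eventually_exists_rat_approx {α : ℝ} (hα : Irrational α)
    (hfin : irrationalityMeasure α < ⊤) :
    ∀ᶠ x : ℝ in atTop, ∀ d : ℕ, 0 < d → (d : ℝ) ≤ Real.exp (errorExponent x) ^ 4 →
      ∃ q : ℚ, |α * d - q| ≤ 1 / (q.den : ℝ) ^ 2 ∧
        2 * Real.exp (errorExponent x) ≤ q.den ∧ (q.den : ℝ) ≤ √x := by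
  obtain ⟨R, c, hc, hdio⟩ := exists_diophantine hα hfin
  have hev : ∀ᶠ x : ℝ in atTop, R * Real.log 2 - Real.log c < 1 / 4 * Real.log x :=
    (Real.tendsto_log_atTop.const_mul_atTop (by norm_num : (0 : ℝ) < 1 / 4)).eventually_gt_atTop _
  filter_upwards [hev, eventually_errorExponent_le (1 / (20 * (R + 1))) (by positivity),
    eventually_ge_atTop 1] with x hx1 hx2 hx d hd hdZ
  have hx0 : 0 < x := by linarith
  have hsx : 1 ≤ √x := Real.one_le_sqrt.mpr hx
  have hn : 0 < ⌊√x⌋₊ := Nat.floor_pos.mpr hsx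
  obtain ⟨q, hq1, hq2⟩ := Real.exists_rat_abs_sub_le_and_den_le (α * d) hn
  have hr : (0 : ℝ) < q.den := by exact_mod_cast q.pos
  have hrn : (q.den : ℝ) ≤ ⌊√x⌋₊ := by exact_mod_cast hq2
  refine ⟨q, hq1.trans ?_, ?_, hrn.trans (Nat.floor_le (by positivity))⟩
  · rw [sq]
    gcongr
    linarith
  -- A denominator below `2 exp L` would give a multiplier `q.den * d ≤ 2 exp (5 L)` with `‖q.den *
  -- d * α‖ ≤ 1 / √x`. This contradicts the Diophantine lower bound, as `L` is small compared with
  -- `log x`.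
  · by_contra hlt
    push Not at hlt
    set L := errorExponent x
    have h1 := hdio (q.den * d) (Nat.mul_pos q.pos hd) q.num
    have hqr : (q : ℝ) = q.num / q.den := Rat.cast_def q
    have h2 : |((q.den * d : ℕ) : ℝ) * α - q.num| ≤ 1 / √x := by
      have h3 : ((q.den * d : ℕ) : ℝ) * α - q.num = q.den * (α * d - q) := by
        rw [hqr]; push_cast; field_simp
      rw [h3, abs_mul, abs_of_pos hr]
      calc (q.den : ℝ) * |α * d - q| ≤ q.den * (1 / ((⌊√x⌋₊ + 1) * q.den)) := by gcongr
        _ = 1 / (⌊√x⌋₊ + 1) := by field_simp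
        _ ≤ 1 / √x := by gcongr; exact (Nat.lt_floor_add_one _).le
    have h3 : ((q.den * d : ℕ) : ℝ) ≤ 2 * Real.exp (5 * L) := by
      push_cast
      calc (q.den : ℝ) * d ≤ (2 * Real.exp L) * Real.exp L ^ 4 := by gcongr
        _ = 2 * Real.exp (5 * L) := by
            rw [show (5 : ℝ) * L = (5 : ℕ) * L by norm_num, Real.exp_nat_mul]; ring
    have h4 : c ≤ (2 * Real.exp (5 * L)) ^ R * (1 / √x) := by
      refine h1.trans ?_
      gcongr
    rw [mul_one_div, le_div_iff₀ (by positivity)] at h4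
    have h5 := Real.log_le_log (by positivity) h4
    rw [Real.log_mul hc.ne' (by positivity), Real.log_sqrt hx0.le, Real.log_pow,
      Real.log_mul two_ne_zero (Real.exp_pos _).ne', Real.log_exp] at h5
    have h6 : (R : ℝ) * (5 * L) ≤ 1 / 4 * Real.log x := by
      have hL0 : 0 ≤ L := Real.sqrt_nonneg _
      calc (R : ℝ) * (5 * L) ≤ (R + 1) * (5 * L) := by gcongr; linarith
        _ ≤ (R + 1) * (5 * (1 / (20 * (R + 1)) * Real.log x)) := by gcongr
        _ = _ := by field_simp; ring
    linarith

/-! ### The Erdős–Turán inequality through the second Bernoulli polynomial. -/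

/-- The `1`-periodic extension of the second Bernoulli polynomial. -/
noncomputable def periodicB2 (t : ℝ) : ℝ := Int.fract t ^ 2 - Int.fract t + 1 / 6

lemma hasSum_periodicB2 (t : ℝ) :
    HasSum (fun h : ℕ => 1 / (h : ℝ) ^ 2 * (expi (h * t)).re) (Real.pi ^ 2 * periodicB2 t) := by
  have h := hasSum_one_div_nat_pow_mul_cos (k := 1) one_ne_zero
    (x := Int.fract t) ⟨Int.fract_nonneg t, (Int.fract_lt_one t).le⟩
  convert h using 1
  · ext n
    rw [mul_one]
    congr 1
    have h1 : expi (n * t) = expi (n * Int.fract t) := by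
      have h2 : (n : ℝ) * t = n * Int.fract t + ((n * ⌊t⌋ : ℤ) : ℝ) := by
        push_cast
        rw [← mul_add, Int.fract_add_floor]
      rw [h2, expi_add, expi_int, mul_one]
    rw [h1, expi, mul_comm Complex.I, Complex.exp_ofReal_mul_I_re]
    ring_nf
  · have h3 : Polynomial.bernoulli (2 * 1) = Polynomial.X ^ 2 - Polynomial.X +
        Polynomial.C (1 / 6 : ℚ) := by
      rw [mul_one, Polynomial.bernoulli]
      simp only [Finset.sum_range_succ, Finset.sum_range_zero, zero_add]
      norm_num [bernoulli_eq_bernoulli'_of_ne_one, bernoulli_one, ← Polynomial.C_mul_X_pow_eq_monomial]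
      ring
    rw [h3, periodicB2]
    simp only [Polynomial.map_add, Polynomial.map_sub, Polynomial.map_pow, Polynomial.map_X,
      Polynomial.map_C, Polynomial.eval_add, Polynomial.eval_sub, Polynomial.eval_pow,
      Polynomial.eval_X, Polynomial.eval_C]
    rw [show Nat.factorial (2 * 1) = 2 from rfl, eq_ratCast]
    push_cast
    ring

/-- The sawtooth has slope 1 and jumps only downwards, so at `t` it exceeds its values on `[t - Δ,
t]` by at most `Δ`. Its mean there is the difference quotient, as it is half the derivative of
`periodicB2`. Unlike the sawtooth, `periodicB2` has an absolutely convergent Fourier series. -/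
lemma fract_sub_half_le {Δ : ℝ} (h0 : 0 < Δ) (h1 : Δ < 1) (t : ℝ) :
    Int.fract t - 1 / 2 ≤ Δ + (periodicB2 t - periodicB2 (t - Δ)) / (2 * Δ) := by
  have hf0 := Int.fract_nonneg t
  have hf1 := Int.fract_lt_one t
  have ht := Int.floor_add_fract t
  rw [← sub_le_iff_le_add', le_div_iff₀ (by positivity), periodicB2, periodicB2]
  set f := Int.fract t
  rcases le_or_gt Δ f with h | h
  · have : Int.fract (t - Δ) = f - Δ :=
      Int.fract_eq_iff.mpr ⟨by linarith, by linarith, ⌊t⌋, by linarith⟩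
    rw [this]; nlinarith
  · have : Int.fract (t - Δ) = f - Δ + 1 :=
      Int.fract_eq_iff.mpr ⟨by linarith, by linarith, ⌊t⌋ - 1, by push_cast; linarith⟩
    rw [this]; nlinarith

lemma le_fract_sub_half {Δ : ℝ} (h0 : 0 < Δ) (h1 : Δ < 1) (t : ℝ) :
    -Δ + (periodicB2 (t + Δ) - periodicB2 t) / (2 * Δ) ≤ Int.fract t - 1 / 2 := by
  have hf0 := Int.fract_nonneg t
  have hf1 := Int.fract_lt_one t
  have ht := Int.floor_add_fract t
  rw [← le_sub_iff_add_le', div_le_iff₀ (by positivity), periodicB2, periodicB2]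
  set f := Int.fract t
  rcases lt_or_ge (f + Δ) 1 with h | h
  · have : Int.fract (t + Δ) = f + Δ :=
      Int.fract_eq_iff.mpr ⟨by linarith, by linarith, ⌊t⌋, by linarith⟩
    rw [this]; nlinarith
  · have : Int.fract (t + Δ) = f + Δ - 1 :=
      Int.fract_eq_iff.mpr ⟨by linarith, by linarith, ⌊t⌋ + 1, by push_cast; linarith⟩
    rw [this]; nlinarith

lemma norm_expi_sub_le (s t : ℝ) : ‖expi s - expi t‖ ≤ 2 * Real.pi * |s - t| := by
  have h1 : expi s - expi t = expi t * (expi (s - t) - 1) := by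
    rw [mul_sub, ← expi_add, mul_one]; congr 2; ring
  rw [h1, norm_mul, norm_expi, one_mul, expi]
  refine (Real.norm_exp_I_mul_ofReal_sub_one_le).trans (le_of_eq ?_)
  rw [Real.norm_eq_abs, abs_mul, abs_of_pos Real.two_pi_pos]

/-- In the Fourier series, frequencies `h ≤ H` use `E` and the Lipschitz bound `2 π h |a - a'|`,
leaving a harmonic sum. Frequencies beyond `H` are bounded trivially against the tail of `∑ 1 / h ^
2`. -/
lemma abs_sum_periodicB2_sub_le {ι : Type*} (F : Finset ι) (t : ι → ℝ) {E : ℝ} {H : ℕ}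
    (hH : 0 < H) (hE0 : 0 ≤ E)
    (hE : ∀ h : ℕ, 0 < h → h ≤ H → ‖∑ n ∈ F, expi (h * t n)‖ ≤ E) (a a' : ℝ) :
    |∑ n ∈ F, (periodicB2 (t n + a) - periodicB2 (t n + a'))| ≤
      |a - a'| * E * (1 + Real.log H) + F.card / H := by
  set G : ℕ → ℝ := fun h => ∑ n ∈ F, (1 / (h : ℝ) ^ 2 * (expi (h * (t n + a))).re -
    1 / (h : ℝ) ^ 2 * (expi (h * (t n + a'))).re) with hG
  have hsum : HasSum G (∑ n ∈ F, (Real.pi ^ 2 * periodicB2 (t n + a) -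
      Real.pi ^ 2 * periodicB2 (t n + a'))) :=
    hasSum_sum fun n _ => (hasSum_periodicB2 _).sub (hasSum_periodicB2 _)
  have hGle (h : ℕ) : |G h| ≤ 1 / (h : ℝ) ^ 2 *
      (‖expi (h * a) - expi (h * a')‖ * ‖∑ n ∈ F, expi (h * t n)‖) := by
    have h1 : G h = 1 / (h : ℝ) ^ 2 *
        ((expi (h * a) - expi (h * a')) * ∑ n ∈ F, expi (h * t n)).re := by
      rw [hG, Finset.mul_sum, Complex.re_sum, Finset.mul_sum]
      refine Finset.sum_congr rfl fun n _ => ?_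
      rw [← mul_sub, ← Complex.sub_re, sub_mul, ← expi_add, ← expi_add]
      ring_nf
    rw [h1, abs_mul, abs_of_nonneg (by positivity : (0 : ℝ) ≤ 1 / (h : ℝ) ^ 2), ← norm_mul]
    gcongr
    exact Complex.abs_re_le_norm _
  have hlow (h : ℕ) (hhH : h ≤ H) :
      |G h| ≤ 2 * Real.pi * (|a - a'| * E) * (1 / (h : ℝ)) := by
    rcases Nat.eq_zero_or_pos h with rfl | hh
    · simpa using hGle 0
    · have hh' : (0 : ℝ) < h := by exact_mod_cast hh
      refine (hGle h).trans ?_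
      have h1 := norm_expi_sub_le (h * a) (h * a')
      rw [← mul_sub, abs_mul, Nat.abs_cast] at h1
      calc _ ≤ 1 / (h : ℝ) ^ 2 * ((2 * Real.pi * (h * |a - a'|)) * E) := by
            gcongr; exact hE h hh hhH
        _ = _ := by field_simp
  have hhigh (h : ℕ) : |G h| ≤ 2 * F.card * ((h : ℝ) ^ 2)⁻¹ := by
    refine (hGle h).trans ?_
    have h1 : ‖expi (h * a) - expi (h * a')‖ ≤ 2 := by
      refine (norm_sub_le _ _).trans ?_
      rw [norm_expi, norm_expi]; norm_num
    have h2 : ‖∑ n ∈ F, expi (h * t n)‖ ≤ F.card := by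
      refine (norm_sum_le _ _).trans ?_
      simp [norm_expi]
    calc _ ≤ 1 / (h : ℝ) ^ 2 * (2 * F.card) := by gcongr
      _ = _ := by rw [one_div]; ring
  have hpart : ∀ᶠ n : ℕ in atTop, |∑ h ∈ Finset.range n, G h| ≤
      2 * Real.pi * (|a - a'| * E) * (1 + Real.log H) + 2 * F.card / H := by
    filter_upwards [eventually_ge_atTop (H + 1)] with n hn
    refine (Finset.abs_sum_le_sum_abs _ _).trans ?_
    rw [← Finset.sum_range_add_sum_Ico _ hn]
    refine add_le_add ?_ ?_
    · refine (Finset.sum_le_sum fun h hh => hlow h (by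
        rw [Finset.mem_range] at hh; omega)).trans ?_
      rw [← Finset.mul_sum]
      have := Real.pi_pos
      gcongr
      rw [Finset.sum_range_succ']
      refine le_trans (le_of_eq ?_) (harmonic_le_one_add_log H)
      rw [harmonic]
      push_cast
      simp
    · refine (Finset.sum_le_sum fun h _ => hhigh h).trans ?_
      rw [← Finset.mul_sum, div_eq_mul_inv]
      gcongr
      obtain ⟨m, rfl⟩ : ∃ m, n = m + 1 := ⟨n - 1, by omega⟩
      have h3 : Finset.Ico (H + 1) (m + 1) = Finset.Ioc H m := by
        ext k; simp only [Finset.mem_Ico, Finset.mem_Ioc]; omega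
      rw [h3]
      refine (sum_Ioc_inv_sq_le_sub (α := ℝ) hH.ne' (by omega)).trans ?_
      have : (0 : ℝ) ≤ (m : ℝ)⁻¹ := by positivity
      linarith
  have hlim := le_of_tendsto (hsum.tendsto_sum_nat.abs) hpart
  have hfac : ∑ n ∈ F, (Real.pi ^ 2 * periodicB2 (t n + a) - Real.pi ^ 2 * periodicB2 (t n + a')) =
      Real.pi ^ 2 * ∑ n ∈ F, (periodicB2 (t n + a) - periodicB2 (t n + a')) := by
    rw [Finset.mul_sum]
    exact Finset.sum_congr rfl fun n _ => by ring
  rw [hfac, abs_mul, abs_of_pos (by positivity : (0 : ℝ) < Real.pi ^ 2)] at hlim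
  have hlogH : 0 ≤ Real.log H := Real.log_natCast_nonneg H
  have hP : 0 ≤ |a - a'| * E * (1 + Real.log H) := by positivity
  have hC : (0 : ℝ) ≤ F.card / H := by positivity
  have hpi := Real.pi_gt_three
  have hle : Real.pi ^ 2 * |∑ n ∈ F, (periodicB2 (t n + a) - periodicB2 (t n + a'))| ≤
      Real.pi ^ 2 * (|a - a'| * E * (1 + Real.log H) + F.card / H) := by
    refine hlim.trans ?_
    rw [mul_div_assoc]
    nlinarith [mul_nonneg (by nlinarith : 0 ≤ Real.pi ^ 2 - 2 * Real.pi) hP,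
      mul_nonneg (by nlinarith : 0 ≤ Real.pi ^ 2 - 2) hC]
  exact le_of_mul_le_mul_left hle (by positivity)

lemma abs_sum_fract_sub_half_le {ι : Type*} (F : Finset ι) (t : ι → ℝ) {E Δ : ℝ} {H : ℕ}
    (hH : 0 < H) (hE0 : 0 ≤ E) (h0 : 0 < Δ) (h1 : Δ < 1)
    (hE : ∀ h : ℕ, 0 < h → h ≤ H → ‖∑ n ∈ F, expi (h * t n)‖ ≤ E) :
    |∑ n ∈ F, (Int.fract (t n) - 1 / 2)| ≤
      Δ * F.card + E * (1 + Real.log H) + F.card / (Δ * H) := by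
  have hH' : (0 : ℝ) < H := by exact_mod_cast hH
  have hlogH : 0 ≤ Real.log H := Real.log_natCast_nonneg H
  have key (a a' : ℝ) (haa : |a - a'| = Δ) :
      |(∑ n ∈ F, (periodicB2 (t n + a) - periodicB2 (t n + a'))) / (2 * Δ)| ≤
        E * (1 + Real.log H) + F.card / (Δ * H) := by
    have h2 := abs_sum_periodicB2_sub_le F t hH hE0 hE a a'
    rw [haa] at h2
    rw [abs_div, abs_of_pos (by positivity : 0 < 2 * Δ), div_le_iff₀ (by positivity)]
    refine h2.trans ?_
    have h3 : (F.card : ℝ) / (Δ * H) * (2 * Δ) = 2 * (F.card / H) := by field_simp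
    have h4 : 0 ≤ (F.card : ℝ) / H := by positivity
    have h5 : 0 ≤ Δ * E * (1 + Real.log H) := by positivity
    rw [add_mul, h3]
    linarith
  rw [abs_le]
  constructor
  · have h2 := Finset.sum_le_sum (s := F) fun n _ => le_fract_sub_half h0 h1 (t n)
    rw [Finset.sum_add_distrib, Finset.sum_const, ← Finset.sum_div, nsmul_eq_mul] at h2
    have h3 := key Δ 0 (by rw [sub_zero, abs_of_pos h0])
    simp only [add_zero] at h3
    have := (abs_le.mp h3).1
    linarith
  · have h2 := Finset.sum_le_sum (s := F) fun n _ => fract_sub_half_le h0 h1 (t n)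
    rw [Finset.sum_add_distrib, Finset.sum_const, ← Finset.sum_div, nsmul_eq_mul] at h2
    have h3 := key 0 (-Δ) (by rw [zero_sub, neg_neg, abs_of_pos h0])
    simp only [add_zero, ← sub_eq_add_neg] at h3
    have := (abs_le.mp h3).2
    linarith

/-- A form of the Erdős–Turán inequality. -/
lemma abs_card_filter_fract_sub_le {ι : Type*} (F : Finset ι) (t : ι → ℝ) {E Δ : ℝ} {H : ℕ}
    (hH : 0 < H) (hE0 : 0 ≤ E) (h0 : 0 < Δ) (h1 : Δ < 1)
    (hE : ∀ h : ℕ, 0 < h → h ≤ H → ‖∑ n ∈ F, expi (h * t n)‖ ≤ E) {y : ℝ} (hy0 : 0 ≤ y)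
    (hy1 : y ≤ 1) :
    |((F.filter fun n => Int.fract (t n) ≤ y).card : ℝ) - y * F.card| ≤
      2 * (Δ * F.card + E * (1 + Real.log H) + F.card / (Δ * H)) := by
  have hlogH : 0 ≤ Real.log H := Real.log_natCast_nonneg H
  rcases hy1.lt_or_eq with hy1 | rfl
  -- For `y < 1` the centred indicator of `{t} ≤ y` is a combination of two sawtooth values. The
  -- sums for `y - t` have the same norms as those for `t`, by conjugation.
  · have hpt : ∀ n ∈ F, (if Int.fract (t n) ≤ y then (1 : ℝ) else 0) - y =
        -(Int.fract (y - t n) - 1 / 2) - (Int.fract (t n) - 1 / 2) := by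
      intro n _
      have hf0 := Int.fract_nonneg (t n)
      have hf1 := Int.fract_lt_one (t n)
      have ht := Int.floor_add_fract (t n)
      split_ifs with h
      · have : Int.fract (y - t n) = y - Int.fract (t n) :=
          Int.fract_eq_iff.mpr ⟨by linarith, by linarith, -⌊t n⌋, by push_cast; linarith⟩
        rw [this]; ring
      · have : Int.fract (y - t n) = y - Int.fract (t n) + 1 :=
          Int.fract_eq_iff.mpr ⟨by linarith, by linarith, -⌊t n⌋ - 1, by push_cast; linarith⟩
        rw [this]; ring
    have hsum : ((F.filter fun n => Int.fract (t n) ≤ y).card : ℝ) - y * F.card =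
        -(∑ n ∈ F, (Int.fract (y - t n) - 1 / 2)) - ∑ n ∈ F, (Int.fract (t n) - 1 / 2) := by
      rw [← Finset.sum_neg_distrib, ← Finset.sum_sub_distrib, ← Finset.sum_congr rfl hpt,
        Finset.sum_sub_distrib, Finset.sum_boole, Finset.sum_const, nsmul_eq_mul]
      ring
    have h2 := abs_sum_fract_sub_half_le F t hH hE0 h0 h1 hE
    have h3 := abs_sum_fract_sub_half_le F (fun n => y - t n) hH hE0 h0 h1 (by
      intro h hh hhH
      refine le_trans (le_of_eq ?_) (hE h hh hhH)
      have h4 : ∑ n ∈ F, expi (h * (y - t n)) =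
          expi (h * y) * (starRingEnd ℂ) (∑ n ∈ F, expi (h * t n)) := by
        rw [map_sum, Finset.mul_sum]
        refine Finset.sum_congr rfl fun n _ => ?_
        rw [conj_expi, ← expi_add]
        congr 1; ring
      rw [h4, norm_mul, norm_expi, one_mul, RCLike.norm_conj])
    rw [hsum]
    refine (abs_sub _ _).trans ?_
    rw [abs_neg]
    linarith
  · rw [Finset.filter_true_of_mem fun n _ => (Int.fract_lt_one _).le, one_mul, sub_self, abs_zero]
    positivity

/-! ### Splitting off the largest prime factor of an element of `𝓑_I`. -/

lemma Nat.primeFactorsList_mul_prime {m p : ℕ} (hm : m ≠ 0) (hp : p.Prime)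
    (h : ∀ q : ℕ, q.Prime → q ∣ m → q ≤ p) :
    (m * p).primeFactorsList = m.primeFactorsList ++ [p] := by
  refine List.Perm.eq_of_pairwise (le := (· ≤ ·)) (fun a b _ _ h1 h2 => le_antisymm h1 h2)
    (Nat.primeFactorsList_sorted _).pairwise ?_ ?_
  · rw [List.pairwise_append]
    refine ⟨(Nat.primeFactorsList_sorted _).pairwise, List.pairwise_singleton _ _, ?_⟩
    intro a ha b hb
    rw [List.mem_singleton] at hb
    rw [hb]
    exact h a (Nat.prime_of_mem_primeFactorsList ha) (Nat.dvd_of_mem_primeFactorsList ha)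
  · have := Nat.perm_primeFactorsList_mul hm hp.ne_zero
    rwa [Nat.primeFactorsList_prime hp] at this

/-- A prime at least as large as all prime factors of `m` is appended at the end of the sorted list:
the earlier conditions are unchanged and one new condition, involving the product `m`, is added. -/
lemma mul_prime_mem_setB_iff {I : ℕ → Set ℝ} {m p : ℕ} (hm : m ≠ 0) (hp : p.Prime)
    (h : ∀ q : ℕ, q.Prime → q ∣ m → q ≤ p) :
    m * p ∈ setB I ↔ m ∈ setB I ∧ (p : ℝ) ∈ I m := by
  simp only [setB, Set.mem_ofPred_eq, Nat.primeFactorsList_mul_prime hm hp h, List.length_append,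
    List.length_singleton]
  constructor
  · rintro ⟨_, h2⟩
    refine ⟨⟨Nat.pos_of_ne_zero hm, fun j hj => ?_⟩, ?_⟩
    · have := h2 j (by omega)
      rwa [List.getElem_append_left hj, List.take_append_of_le_length hj.le] at this
    · have := h2 m.primeFactorsList.length (by omega)
      rwa [List.getElem_concat_length rfl, List.take_left, Nat.prod_primeFactorsList hm] at this
  · rintro ⟨⟨_, h2⟩, h3⟩
    refine ⟨Nat.mul_pos (Nat.pos_of_ne_zero hm) hp.pos, fun j hj => ?_⟩
    rcases Nat.lt_or_ge j m.primeFactorsList.length with hlt | hge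
    · rw [List.getElem_append_left hlt, List.take_append_of_le_length hlt.le]
      exact h2 j hlt
    · have hj' : j = m.primeFactorsList.length := by omega
      subst hj'
      rw [List.getElem_concat_length rfl, List.take_left, Nat.prod_primeFactorsList hm]
      exact h3

/-- The largest prime factor of `n` (and `0` if there is none). -/
def maxPrimeFactor (n : ℕ) : ℕ := n.primeFactors.sup id

lemma le_maxPrimeFactor {n q : ℕ} (hn : n ≠ 0) (hq : q.Prime) (h : q ∣ n) :
    q ≤ maxPrimeFactor n :=
  Finset.le_sup (f := id) (Nat.mem_primeFactors.mpr ⟨hq, h, hn⟩)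

lemma maxPrimeFactor_mem {n q : ℕ} (hn : n ≠ 0) (hq : q.Prime) (h : q ∣ n) :
    (maxPrimeFactor n).Prime ∧ maxPrimeFactor n ∣ n := by
  obtain ⟨l, hl, hl2⟩ := Finset.exists_mem_eq_sup n.primeFactors
    ⟨q, Nat.mem_primeFactors.mpr ⟨hq, h, hn⟩⟩ id
  rw [maxPrimeFactor, hl2]
  exact ⟨Nat.prime_of_mem_primeFactors hl, Nat.dvd_of_mem_primeFactors hl⟩

lemma maxPrimeFactor_mul_prime {m p : ℕ} (hm : m ≠ 0) (hp : p.Prime)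
    (h : ∀ q : ℕ, q.Prime → q ∣ m → q ≤ p) : maxPrimeFactor (m * p) = p := by
  have hne : m * p ≠ 0 := mul_ne_zero hm hp.ne_zero
  refine le_antisymm ?_ (le_maxPrimeFactor hne hp (Dvd.intro_left _ rfl))
  obtain ⟨h1, h2⟩ := maxPrimeFactor_mem hne hp (Dvd.intro_left _ rfl)
  rcases h1.dvd_mul.mp h2 with h3 | h3
  · exact h _ h1 h3
  · exact Nat.le_of_dvd hp.pos h3

open Classical in
/-- The elements of `𝓑_I` in `[1, x]`. -/
noncomputable def finsetB (I : ℕ → Set ℝ) (x : ℝ) : Finset ℕ :=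
  (Finset.Icc 1 ⌊x⌋₊).filter (· ∈ setB I)

lemma mem_finsetB {I : ℕ → Set ℝ} {x : ℝ} (hx : 0 ≤ x) {n : ℕ} :
    n ∈ finsetB I x ↔ n ∈ setB I ∧ (n : ℝ) ≤ x := by
  classical
  rw [finsetB, Finset.mem_filter, Finset.mem_Icc, Nat.le_floor_iff hx]
  constructor
  · exact fun h => ⟨h.2, h.1.2⟩
  · exact fun h => ⟨⟨h.1.1, h.2⟩, h.1⟩

lemma card_finsetB_le (I : ℕ → Set ℝ) {x : ℝ} (hx : 0 ≤ x) : ((finsetB I x).card : ℝ) ≤ x := by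
  classical
  have h := Finset.card_filter_le (Finset.Icc 1 ⌊x⌋₊) (· ∈ setB I)
  rw [Nat.card_Icc, Nat.add_sub_cancel] at h
  refine le_trans ?_ (Nat.floor_le hx)
  rw [finsetB]
  exact_mod_cast h

lemma countB_eq (I : ℕ → Set ℝ) {x : ℝ} (hx : 0 ≤ x) : countB I x = (finsetB I x).card := by
  rw [countB, ← Set.ncard_coe_finset]
  congr 1
  ext n
  rw [Finset.mem_coe, mem_finsetB hx]
  rfl

lemma countBFract_eq (I : ℕ → Set ℝ) (α : ℝ) {x : ℝ} (hx : 0 ≤ x) (y : ℝ) :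
    countBFract I α x y = ((finsetB I x).filter fun n : ℕ => Int.fract (α * n) ≤ y).card := by
  rw [countBFract, ← Set.ncard_coe_finset]
  congr 1
  ext n
  rw [Finset.mem_coe, Finset.mem_filter, mem_finsetB hx, and_assoc]
  rfl

open Classical in
/-- The primes `p` such that `m * p ≤ x` belongs to `𝓑_I` and has `p ≥ Z` as its largest prime
factor, for `m ∈ 𝓑_I`. -/
noncomputable def extendingPrimes (I : ℕ → Set ℝ) (x Z : ℝ) (m : ℕ) : Finset ℕ :=
  (Finset.range (⌊x⌋₊ + 1)).filter fun p => p.Prime ∧ Z ≤ (p : ℝ) ∧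
    (∀ q : ℕ, q.Prime → q ∣ m → q ≤ p) ∧ (p : ℝ) ∈ I m ∧ (m * p : ℝ) ≤ x

lemma sum_finsetB_filter_not_smooth (I : ℕ → Set ℝ) {x : ℝ} (hx : 0 ≤ x) (Z : ℝ) (f : ℕ → ℂ) :
    ∑ n ∈ (finsetB I x).filter (fun n => ¬ n ∈ Nat.smoothNumbers ⌈Z⌉₊), f n =
      ∑ m ∈ finsetB I x, ∑ p ∈ extendingPrimes I x Z m, f (m * p) := by
  classical
  rw [Finset.sum_sigma']
  refine Finset.sum_bij' (fun n _ => ⟨n / maxPrimeFactor n, maxPrimeFactor n⟩)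
    (fun y _ => y.1 * y.2) ?_ ?_ ?_ ?_ ?_
  · intro n hn
    obtain ⟨hnB, hns⟩ := Finset.mem_filter.mp hn
    obtain ⟨hnI, hnx⟩ := (mem_finsetB hx).mp hnB
    have hn0 : n ≠ 0 := hnI.1.ne'
    have hex : ∃ l : ℕ, l.Prime ∧ l ∣ n ∧ Z ≤ l := by
      by_contra hcon
      push Not at hcon
      exact hns (Nat.mem_smoothNumbers'.mpr fun l hl hln => Nat.lt_ceil.mpr (hcon l hl hln))
    obtain ⟨l, hl, hln, hlZ⟩ := hex
    obtain ⟨hp, hpn⟩ := maxPrimeFactor_mem hn0 hl hln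
    have hlp : (l : ℝ) ≤ maxPrimeFactor n := by exact_mod_cast le_maxPrimeFactor hn0 hl hln
    have hmul : n / maxPrimeFactor n * maxPrimeFactor n = n := Nat.div_mul_cancel hpn
    set p := maxPrimeFactor n with hpdef
    set m := n / p with hmdef
    have hm0 : m ≠ 0 := by
      intro h; rw [h, zero_mul] at hmul; exact hn0 hmul.symm
    have hmn : m ∣ n := Dvd.intro _ hmul
    have hmax : ∀ q : ℕ, q.Prime → q ∣ m → q ≤ p := fun q hq hqm =>
      le_maxPrimeFactor hn0 hq (hqm.trans hmn)
    rw [← hmul, mul_prime_mem_setB_iff hm0 hp hmax] at hnI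
    have hmx : (m : ℝ) ≤ x := le_trans (by exact_mod_cast Nat.le_of_dvd (by omega) hmn) hnx
    have hpx : (p : ℝ) ≤ x := le_trans (by exact_mod_cast Nat.le_of_dvd (by omega) hpn) hnx
    rw [Finset.mem_sigma, mem_finsetB hx, extendingPrimes, Finset.mem_filter, Finset.mem_range,
      Nat.lt_succ_iff]
    refine ⟨⟨hnI.1, hmx⟩, Nat.le_floor hpx, hp, hlZ.trans hlp, hmax, hnI.2, ?_⟩
    rw [← Nat.cast_mul, hmul]
    exact hnx
  · rintro ⟨m, p⟩ hy
    rw [Finset.mem_sigma, mem_finsetB hx, extendingPrimes, Finset.mem_filter] at hy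
    obtain ⟨⟨hmI, hmx⟩, -, hp, hpZ, hmax, hpI, hpx⟩ := hy
    simp only at *
    rw [Finset.mem_filter, mem_finsetB hx, mul_prime_mem_setB_iff hmI.1.ne' hp hmax,
      Nat.mem_smoothNumbers']
    refine ⟨⟨⟨hmI, hpI⟩, by push_cast; exact hpx⟩, fun hcon => ?_⟩
    exact absurd (Nat.lt_ceil.mp (hcon p hp (Dvd.intro_left _ rfl))) (not_lt.mpr hpZ)
  · intro n hn
    obtain ⟨hnB, hns⟩ := Finset.mem_filter.mp hn
    obtain ⟨hnI, hnx⟩ := (mem_finsetB hx).mp hnB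
    have hex : ∃ l : ℕ, l.Prime ∧ l ∣ n := by
      by_contra hcon
      push Not at hcon
      exact hns (Nat.mem_smoothNumbers'.mpr fun l hl hln => absurd hln (hcon l hl))
    obtain ⟨l, hl, hln⟩ := hex
    exact Nat.div_mul_cancel (maxPrimeFactor_mem hnI.1.ne' hl hln).2
  · rintro ⟨m, p⟩ hy
    rw [Finset.mem_sigma, mem_finsetB hx, extendingPrimes, Finset.mem_filter] at hy
    obtain ⟨⟨hmI, hmx⟩, -, hp, hpZ, hmax, hpI, hpx⟩ := hy
    simp only [maxPrimeFactor_mul_prime hmI.1.ne' hp hmax, Nat.mul_div_cancel _ hp.pos]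
  · intro n hn
    obtain ⟨hnB, hns⟩ := Finset.mem_filter.mp hn
    obtain ⟨hnI, hnx⟩ := (mem_finsetB hx).mp hnB
    have hex : ∃ l : ℕ, l.Prime ∧ l ∣ n := by
      by_contra hcon
      push Not at hcon
      exact hns (Nat.mem_smoothNumbers'.mpr fun l hl hln => absurd hln (hcon l hl))
    obtain ⟨l, hl, hln⟩ := hex
    rw [Nat.div_mul_cancel (maxPrimeFactor_mem hnI.1.ne' hl hln).2]

/-! ### Exponential sums over `𝓑_I`. -/

/-- The exponential sum over the products `m * p`, where for each `m` the prime `p` runs over an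
interval. -/
lemma sum_norm_mul_prime_le {x Z β τ : ℝ} (hZ : 2 ≤ Z) (hZx : Z ≤ x)
    (happ : ∀ m : ℕ, 0 < m → (m : ℝ) ≤ Z → ∃ q : ℚ, |β * m - q| ≤ 1 / (q.den : ℝ) ^ 2 ∧
      2 * Z ≤ q.den ∧ q.den * Z ^ 3 ≤ x)
    (hτ : ∀ X : ℝ, x / Z ≤ X → smoothTail Z (X / Z ^ 2) X ≤ τ) {Ms : Finset ℕ}
    (hMs : ∀ m ∈ Ms, 0 < m) {S : ℕ → Finset ℕ} (hS : ∀ m, (S m : Set ℕ).OrdConnected)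
    (hSx : ∀ m ∈ Ms, ∀ p ∈ S m, Z ≤ p ∧ (m * p : ℝ) ≤ x) :
    ∑ m ∈ Ms, ‖∑ p ∈ S m, if p.Prime then expi (β * m * p) else 0‖ ≤
      x * (303 * (1 + Real.log x) ^ 4 / √Z + (1 + Real.log x) * τ) := by
  have hZ0 : 0 < Z := by linarith
  have hx0 : 0 < x := by linarith
  set l := 1 + Real.log x with hl
  have hl1 : 1 ≤ l := by have := Real.log_nonneg (by linarith : 1 ≤ x); linarith
  have hτ0 : 0 ≤ τ := (Finset.sum_nonneg fun _ _ => by positivity).trans (hτ _ le_rfl)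
  rw [← Finset.sum_filter_add_sum_filter_not Ms (fun m : ℕ => (m : ℝ) ≤ Z)]
  -- For `m ≤ Z`, use the prime estimate up to `x / m` with the approximation to `β m`; summing `1 /
  -- m` costs one logarithm.
  have hsmall : ∑ m ∈ Ms.filter (fun m : ℕ => (m : ℝ) ≤ Z),
      ‖∑ p ∈ S m, if p.Prime then expi (β * m * p) else 0‖ ≤
        x * (203 * l ^ 3 / √Z + τ) * l := by
    have h1 : ∀ m ∈ Ms.filter (fun m : ℕ => (m : ℝ) ≤ Z),
        ‖∑ p ∈ S m, if p.Prime then expi (β * m * p) else 0‖ ≤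
          x * (203 * l ^ 3 / √Z + τ) * (m : ℝ)⁻¹ := by
      intro m hm
      obtain ⟨hm1, hmZ⟩ := Finset.mem_filter.mp hm
      have hm0 : (0 : ℝ) < m := by exact_mod_cast hMs m hm1
      have hm1' : (1 : ℝ) ≤ m := by exact_mod_cast hMs m hm1
      obtain ⟨q, hq, hq1, hq2⟩ := happ m (hMs m hm1) hmZ
      have hX : x / Z ≤ x / m := by gcongr
      have h2 : (q.den : ℝ) * Z ^ 2 ≤ x / m := by
        rw [le_div_iff₀ hm0]
        calc (q.den : ℝ) * Z ^ 2 * m ≤ q.den * Z ^ 2 * Z := by gcongr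
          _ = q.den * Z ^ 3 := by ring
          _ ≤ x := hq2
      have h3 := norm_sum_prime_le hZ hq hq1 h2 (hS m) (fun p hp => by
        obtain ⟨h4, h5⟩ := hSx m hm1 p hp
        refine ⟨h4, ?_⟩
        rw [le_div_iff₀ hm0]; linarith)
      rw [← Finset.sum_filter]
      refine h3.trans ?_
      have h6 : 1 + Real.log (x / m) ≤ l := by
        have : Real.log (x / m) ≤ Real.log x :=
          Real.log_le_log (by positivity) (div_le_self hx0.le hm1')
        linarith
      have h7 : 0 ≤ 1 + Real.log (x / m) := by
        have : 1 ≤ x / m := by rw [le_div_iff₀ hm0]; linarith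
        have := Real.log_nonneg this
        linarith
      calc _ ≤ 203 * l ^ 3 * (x / m / √Z) + x / m * τ := by
            gcongr; exact hτ _ hX
        _ = _ := by rw [div_eq_mul_inv x]; ring
    refine (Finset.sum_le_sum h1).trans ?_
    rw [← Finset.mul_sum]
    refine mul_le_mul_of_nonneg_left ?_ (by positivity)
    have h2 : Ms.filter (fun m : ℕ => (m : ℝ) ≤ Z) ⊆ Finset.Icc 1 ⌊Z⌋₊ := by
      intro m hm
      obtain ⟨hm1, hmZ⟩ := Finset.mem_filter.mp hm
      exact Finset.mem_Icc.mpr ⟨hMs m hm1, Nat.le_floor hmZ⟩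
    have h3 := harmonic_floor_le_one_add_log Z (by linarith)
    rw [harmonic_eq_sum_Icc] at h3
    push_cast at h3
    have h4 := Real.log_le_log hZ0 hZx
    calc _ ≤ ∑ m ∈ Finset.Icc 1 ⌊Z⌋₊, (m : ℝ)⁻¹ :=
          Finset.sum_le_sum_of_subset_of_nonneg h2 fun _ _ _ => by positivity
      _ ≤ l := by linarith
  -- For `m > Z` both variables are at least `Z`, and a single approximation to `β` itself suffices.
  have hlarge : ∑ m ∈ Ms.filter (fun m : ℕ => ¬ (m : ℝ) ≤ Z),
      ‖∑ p ∈ S m, if p.Prime then expi (β * m * p) else 0‖ ≤ 100 * l ^ 3 * (x / √Z) := by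
    obtain ⟨q, hq, hq1, hq2⟩ := happ 1 one_pos (by push_cast; linarith)
    rw [Nat.cast_one, mul_one] at hq
    have h1 : ∀ m ∈ Ms.filter (fun m : ℕ => ¬ (m : ℝ) ≤ Z),
        ‖∑ p ∈ S m, if p.Prime then expi (β * m * p) else 0‖ =
        ‖∑ p ∈ S m, (if p.Prime then 1 else 0) * expi (β * m * p)‖ := by
      intro m _
      congr 1
      refine Finset.sum_congr rfl fun p _ => ?_
      split_ifs <;> simp
    rw [Finset.sum_congr rfl h1]
    refine bilinear_le (by linarith) hq (by linarith) ?_ (b := fun p => if p.Prime then 1 else 0)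
      ?_ ?_ hS ?_
    · have : Z ≤ Z ^ 3 := le_self_pow₀ (by linarith) (by norm_num)
      exact (mul_le_mul_of_nonneg_left this (Nat.cast_nonneg _)).trans hq2
    · intro p
      split_ifs <;> simp
    · intro m hm
      exact (not_le.mp (Finset.mem_filter.mp hm).2).le
    · intro m hm p hp
      exact hSx m (Finset.mem_filter.mp hm).1 p hp
  refine (add_le_add hsmall hlarge).trans ?_
  have h5 : 0 ≤ x / √Z := by positivity
  have h6 : l ^ 3 * (x / √Z) ≤ l ^ 4 * (x / √Z) := by
    exact mul_le_mul_of_nonneg_right (pow_le_pow_right₀ hl1 (by norm_num)) h5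
  have h7 : x * (203 * l ^ 3 / √Z + τ) * l = 203 * (l ^ 4 * (x / √Z)) + x * (l * τ) := by ring
  have h8 : x * (303 * l ^ 4 / √Z + l * τ) = 303 * (l ^ 4 * (x / √Z)) + x * (l * τ) := by ring
  rw [h7, h8]
  linarith

/-- The sets may overlap. Inclusion–exclusion involves only their intersections, which for intervals
are again intervals. -/
lemma norm_sum_biUnion_le {ι : Type*} (s : Finset ι) (S : ι → Finset ℕ) (f : ℕ → ℂ) :
    ‖∑ n ∈ s.biUnion S, f n‖ ≤
      ∑ t : s.powerset.filter (·.Nonempty),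
        ‖∑ n ∈ t.1.inf' (Finset.mem_filter.mp t.2).2 S, f n‖ := by
  rw [Finset.inclusion_exclusion_sum_biUnion]
  refine (norm_sum_le _ _).trans (Finset.sum_le_sum fun t _ => ?_)
  rcases neg_one_pow_eq_or ℤ ((t : Finset ι).card + 1) with h | h <;> rw [h] <;> simp

lemma Finset.mem_inf'_iff {ι : Type*} {t : Finset ι} (ht : t.Nonempty) (S : ι → Finset ℕ)
    (n : ℕ) : n ∈ t.inf' ht S ↔ ∀ i ∈ t, n ∈ S i := by
  rw [← Finset.singleton_subset_iff, Finset.le_inf'_iff]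
  simp

-- Smooth elements are counted trivially; each other element is `m p` with `p` its largest prime
-- factor. The further constraints on `p` (at least `Z`, at least every prime factor of `m`, `m p ≤
-- x`) also define intervals, so intersecting them with the `K` given ones keeps the interval
-- structure.
open Classical in
lemma norm_sum_finsetB_le {I : ℕ → Set ℝ} {K : ℕ}
    (hI : ∀ n : ℕ, 1 ≤ n → IsUnionOfIntervals K (I n)) {x Z β τ : ℝ} (hZ : 2 ≤ Z) (hZx : Z ≤ x)
    (happ : ∀ m : ℕ, 0 < m → (m : ℝ) ≤ Z → ∃ q : ℚ, |β * m - q| ≤ 1 / (q.den : ℝ) ^ 2 ∧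
      2 * Z ≤ q.den ∧ q.den * Z ^ 3 ≤ x)
    (hτ : ∀ X : ℝ, x / Z ≤ X → smoothTail Z (X / Z ^ 2) X ≤ τ) :
    ‖∑ n ∈ finsetB I x, expi (β * n)‖ ≤ (Nat.smoothNumbersUpTo ⌊x⌋₊ ⌈Z⌉₊).card +
      2 ^ K * (x * (303 * (1 + Real.log x) ^ 4 / √Z + (1 + Real.log x) * τ)) := by
  have hx0 : 0 ≤ x := by linarith
  have hex : ∀ m : ℕ, ∃ J : Fin K → Set ℝ, (∀ i, (J i).OrdConnected) ∧
      (1 ≤ m → I m = ⋃ i, J i) := by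
    intro m
    rcases Nat.lt_or_ge m 1 with h | h
    · exact ⟨fun _ => ∅, fun _ => Set.ordConnected_empty, fun h' => by omega⟩
    · obtain ⟨J, h1, h2⟩ := hI m h
      exact ⟨J, h1, fun _ => h2⟩
  choose J hJo hJI using hex
  let S : ℕ → Fin K → Finset ℕ := fun m i => (Finset.range (⌊x⌋₊ + 1)).filter fun p =>
    Z ≤ (p : ℝ) ∧ (∀ q : ℕ, q.Prime → q ∣ m → q ≤ p) ∧ (p : ℝ) ∈ J m i ∧ (m * p : ℝ) ≤ x
  have hSo (m : ℕ) (i : Fin K) : (S m i : Set ℕ).OrdConnected := by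
    constructor
    intro a ha c hc k hk
    simp only [S, Finset.coe_filter, Finset.mem_range, Set.mem_ofPred_eq] at ha hc ⊢
    have h1 : (a : ℝ) ≤ k := by exact_mod_cast hk.1
    have h2 : (k : ℝ) ≤ c := by exact_mod_cast hk.2
    refine ⟨by have := hk.2; omega, ha.2.1.trans h1, fun q hq hqm => ?_, ?_, ?_⟩
    · exact (ha.2.2.1 q hq hqm).trans hk.1
    · exact (hJo m i).out ha.2.2.2.1 hc.2.2.2.1 ⟨h1, h2⟩
    · exact le_trans (by gcongr) hc.2.2.2.2
  have hext : ∀ m ∈ finsetB I x, ∑ p ∈ extendingPrimes I x Z m, expi (β * (m * p : ℕ)) =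
      ∑ p ∈ Finset.univ.biUnion (S m), if p.Prime then expi (β * m * p) else 0 := by
    intro m hm
    have hm1 : 1 ≤ m := ((mem_finsetB hx0).mp hm).1.1
    rw [← Finset.sum_filter]
    refine Finset.sum_congr ?_ fun p _ => by push_cast; rw [mul_assoc]
    ext p
    simp only [extendingPrimes, Finset.mem_filter, Finset.mem_biUnion, Finset.mem_univ, true_and,
      S, hJI m hm1, Set.mem_iUnion]
    constructor
    · rintro ⟨h1, h2, h3, h4, ⟨i, h5⟩, h6⟩
      exact ⟨⟨i, h1, h3, h4, h5, h6⟩, h2⟩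
    · rintro ⟨⟨i, h1, h3, h4, h5, h6⟩, h2⟩
      exact ⟨h1, h2, h3, h4, ⟨i, h5⟩, h6⟩
  rw [← Finset.sum_filter_add_sum_filter_not (finsetB I x)
    (fun n => n ∈ Nat.smoothNumbers ⌈Z⌉₊)]
  refine (norm_add_le _ _).trans (add_le_add ?_ ?_)
  · refine (norm_sum_le _ _).trans ?_
    simp only [norm_expi, Finset.sum_const, nsmul_eq_mul, mul_one]
    refine Nat.cast_le.mpr (Finset.card_le_card fun n hn => ?_)
    obtain ⟨h1, h2⟩ := Finset.mem_filter.mp hn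
    exact Nat.mem_smoothNumbersUpTo.mpr ⟨Nat.le_floor ((mem_finsetB hx0).mp h1).2, h2⟩
  · rw [sum_finsetB_filter_not_smooth I hx0, Finset.sum_congr rfl hext]
    refine (norm_sum_le _ _).trans ?_
    refine (Finset.sum_le_sum fun m _ => norm_sum_biUnion_le _ (S m) _).trans ?_
    rw [Finset.sum_comm]
    set B := x * (303 * (1 + Real.log x) ^ 4 / √Z + (1 + Real.log x) * τ) with hB
    have hle (Ts : (Finset.univ : Finset (Fin K)).powerset.filter (·.Nonempty)) :
        ∑ m ∈ finsetB I x, ‖∑ p ∈ Ts.1.inf' (Finset.mem_filter.mp Ts.2).2 (S m),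
          if p.Prime then expi (β * m * p) else 0‖ ≤ B := by
      have hne := (Finset.mem_filter.mp Ts.2).2
      refine sum_norm_mul_prime_le hZ hZx happ hτ ?_ ?_ ?_
      · exact fun m hm => ((mem_finsetB hx0).mp hm).1.1
      · intro m
        have : ((Ts.1.inf' hne (S m) : Finset ℕ) : Set ℕ) = ⋂ i ∈ Ts.1, (S m i : Set ℕ) := by
          ext n
          simp
        rw [this]
        exact Set.ordConnected_biInter fun i _ => hSo m i
      · intro m _ p hp
        obtain ⟨i, hi⟩ := hne
        have h1 := (Finset.mem_inf'_iff _ _ _).mp hp i hi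
        simp only [S, Finset.mem_filter] at h1
        exact ⟨h1.2.1, h1.2.2.2.2⟩
    have hB0 : 0 ≤ B := by
      have hτ0 : 0 ≤ τ := (Finset.sum_nonneg fun _ _ => by positivity).trans (hτ _ le_rfl)
      have := Real.log_nonneg (by linarith : 1 ≤ x)
      positivity
    refine (Finset.sum_le_sum fun Ts _ => hle Ts).trans ?_
    rw [Finset.sum_const, nsmul_eq_mul]
    refine mul_le_mul_of_nonneg_right ?_ hB0
    rw [Finset.card_univ, Fintype.card_coe]
    have := Finset.card_filter_le (Finset.univ : Finset (Fin K)).powerset (·.Nonempty)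
    rw [Finset.card_powerset, Finset.card_univ, Fintype.card_fin] at this
    exact_mod_cast this

/-! ### The discrepancy estimate. -/

lemma errorExponent_nonneg (x : ℝ) : 0 ≤ errorExponent x := Real.sqrt_nonneg _

lemma tendsto_errorExponent : Tendsto errorExponent atTop atTop := by
  have h : Tendsto (fun x : ℝ => √(Real.log x)) atTop atTop :=
    Real.tendsto_sqrt_atTop.comp Real.tendsto_log_atTop
  exact tendsto_atTop_mono' _ (eventually_sqrt_log_le_errorExponent.mono fun _ hx => hx.1) h

/-- The main estimate: a quantitative form of the equidistribution of `α n`, `n ∈ 𝓑_I`. -/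
lemma eventually_discrepancyB_le {α : ℝ} (hα : Irrational α) (hfin : irrationalityMeasure α < ⊤) :
    ∀ᶠ x : ℝ in atTop, ∀ (K : ℕ) (I : ℕ → Set ℝ),
      (∀ n : ℕ, 1 ≤ n → IsUnionOfIntervals K (I n)) →
        discrepancyB I α x ≤ 2000 * 2 ^ K * (x * Real.exp (-0.42 * errorExponent x)) := by
  filter_upwards [eventually_exists_rat_approx hα hfin, eventually_smooth_le,
    eventually_mul_log_le_errorExponent 10 0.02 (by norm_num),
    eventually_sqrt_log_le_errorExponent, eventually_errorExponent_le (1 / 6) (by norm_num),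
    tendsto_errorExponent.eventually_ge_atTop 1, eventually_ge_atTop 1,
    Real.tendsto_log_atTop.eventually_ge_atTop 3]
    with x happ hsm hlog hLu hL6 hL1 hx hu3 K I hI
  set L := errorExponent x with hL
  set u := Real.log x with hu
  set Z := Real.exp L with hZdef
  set l := 1 + u with hl
  have hx0 : 0 < x := by linarith
  have hu0 : 0 < u := by linarith
  have hl1 : 1 ≤ l := by linarith
  have hZ2 : 2 ≤ Z := by
    have := Real.exp_one_gt_d9
    have h1 := Real.exp_le_exp.mpr hL1
    linarith
  have hZ0 : 0 < Z := by linarith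
  have hZx : Z ≤ x := by
    rw [hZdef, ← Real.le_log_iff_exp_le hx0]; exact hLu.2.1
  have hZ3 : Z ^ 3 ≤ √x := by
    rw [hZdef, ← Real.exp_nat_mul, ← Real.le_log_iff_exp_le (Real.sqrt_pos.mpr hx0),
      Real.log_sqrt hx0.le, ← hu]
    push_cast; linarith
  set w := Real.exp (-0.44 * L) with hw
  have hw0 : 0 < w := Real.exp_pos _
  -- With `Δ = 1 / Z` in the Erdős–Turán bound, `H ≥ Z ^ 2` makes both `Δ` and `1 / (Δ H)` at most
  -- `1 / Z`. The multipliers `h m` stay below `Z ^ 3 * Z`, within the range of the rational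
  -- approximations.
  set H := ⌈Z ^ 2⌉₊ with hHdef
  have hH0 : 0 < H := Nat.ceil_pos.mpr (by positivity)
  have hH1 : Z ^ 2 ≤ H := Nat.le_ceil _
  have hH3 : (H : ℝ) ≤ Z ^ 3 := by
    have := (Nat.ceil_lt_add_one (by positivity : (0 : ℝ) ≤ Z ^ 2)).le
    nlinarith
  set E := 305 * 2 ^ K * (x * (l ^ 4 * w)) with hE
  have hE0 : 0 ≤ E := by positivity
  have h2K : (1 : ℝ) ≤ 2 ^ K := one_le_pow₀ one_le_two
  have hexp : ∀ h : ℕ, 0 < h → h ≤ H → ‖∑ n ∈ finsetB I x, expi (h * (α * n))‖ ≤ E := by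
    intro h hh hhH
    have hhH' : (h : ℝ) ≤ Z ^ 3 := le_trans (by exact_mod_cast hhH) hH3
    have h1 := norm_sum_finsetB_le hI (β := α * h) (τ := w) hZ2 hZx ?_ hsm.2
    · have h2 : ∑ n ∈ finsetB I x, expi (h * (α * n)) = ∑ n ∈ finsetB I x, expi (α * h * n) :=
        Finset.sum_congr rfl fun n _ => by ring_nf
      rw [h2]
      refine h1.trans ?_
      have h3 : 1 / √Z ≤ w := by
        rw [hw, hZdef, ← Real.exp_half, one_div, ← Real.exp_neg, Real.exp_le_exp]
        linarith
      have h4 : l * w ≤ l ^ 4 * w := by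
        gcongr; exact le_self_pow₀ hl1 (by norm_num)
      have h5 : w ≤ l ^ 4 * w := le_mul_of_one_le_left hw0.le (one_le_pow₀ hl1)
      calc _ ≤ x * w + 2 ^ K * (x * (303 * l ^ 4 * w + l * w)) := by
            gcongr
            · exact hsm.1
            · rw [div_eq_mul_one_div]
              gcongr
        _ ≤ 2 ^ K * (x * (l ^ 4 * w)) + 2 ^ K * (x * (303 * l ^ 4 * w + l ^ 4 * w)) := by
            refine add_le_add ?_ (by gcongr)
            calc x * w ≤ x * (l ^ 4 * w) := by gcongr
              _ ≤ _ := le_mul_of_one_le_left (by positivity) h2K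
        _ = E := by rw [hE]; ring
    · intro m hm hmZ
      obtain ⟨q, hq1, hq2, hq3⟩ := happ (h * m) (Nat.mul_pos hh hm) (by
        push_cast
        calc (h : ℝ) * m ≤ Z ^ 3 * Z := by gcongr
          _ = Z ^ 4 := by ring)
      refine ⟨q, ?_, hq2, ?_⟩
      · push_cast at hq1
        rwa [← mul_assoc] at hq1
      · calc (q.den : ℝ) * Z ^ 3 ≤ √x * √x := by gcongr
          _ = x := Real.mul_self_sqrt hx0.le
  have : Nonempty (Set.Icc (0 : ℝ) 1) := ⟨⟨0, by simp⟩⟩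
  refine ciSup_le fun y => ?_
  obtain ⟨y, hy0, hy1⟩ := y
  have hcard := card_finsetB_le I hx0.le
  have hET := abs_card_filter_fract_sub_le (finsetB I x) (fun n : ℕ => α * n) hH0 hE0
    (show (0 : ℝ) < 1 / Z by positivity)
    (show 1 / Z < 1 by rw [div_lt_one hZ0]; linarith) hexp hy0 hy1
  simp only
  rw [countB_eq I hx0.le, countBFract_eq I α hx0.le]
  refine hET.trans ?_
  have hZw : 1 / Z ≤ w := by
    rw [hw, hZdef, one_div, ← Real.exp_neg, Real.exp_le_exp]; linarith
  have hlogH : 1 + Real.log H ≤ 3 * l := by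
    have h1 := Real.log_le_log (by exact_mod_cast hH0) hH3
    rw [hZdef, ← Real.exp_nat_mul, Real.log_exp] at h1
    push_cast at h1
    have := hLu.2.1
    linarith
  have hlogH0 : 0 ≤ Real.log H := Real.log_natCast_nonneg H
  have t1 : 1 / Z * ((finsetB I x).card : ℝ) ≤ w * x := by gcongr
  have t2 : E * (1 + Real.log H) ≤ E * (3 * l) := by gcongr
  have t3 : ((finsetB I x).card : ℝ) / (1 / Z * H) ≤ x * w := by
    have h1 : Z ≤ 1 / Z * H := by
      rw [one_div, inv_mul_eq_div, le_div_iff₀ hZ0]; linarith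
    calc ((finsetB I x).card : ℝ) / (1 / Z * H) ≤ x / Z := by gcongr
      _ = x * (1 / Z) := by rw [mul_one_div]
      _ ≤ x * w := by gcongr
  -- Four logarithms come from the exponential sum and one from the harmonic sum over frequencies.
  -- Together they cost `exp (0.02 L)`, reducing the exponent from `0.44` to `0.42`.
  have hl5 : l ^ 5 ≤ Real.exp (0.02 * L) := by
    have h1 : l ≤ u ^ 2 := by nlinarith
    calc l ^ 5 ≤ (u ^ 2) ^ 5 := by gcongr
      _ = u ^ 10 := by ring
      _ = Real.exp (10 * Real.log u) := by
          rw [show (10 : ℝ) = (10 : ℕ) by norm_num, Real.exp_nat_mul, Real.exp_log hu0]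
      _ ≤ _ := Real.exp_le_exp.mpr hlog
  have t4 : x * w ≤ 2 ^ K * (x * (l ^ 5 * w)) := by
    have : w ≤ l ^ 5 * w := le_mul_of_one_le_left hw0.le (one_le_pow₀ hl1)
    calc x * w ≤ x * (l ^ 5 * w) := by gcongr
      _ ≤ _ := le_mul_of_one_le_left (by positivity) h2K
  have t5 : l ^ 5 * w ≤ Real.exp (-0.42 * L) := by
    calc l ^ 5 * w ≤ Real.exp (0.02 * L) * w := by gcongr
      _ = _ := by rw [hw, ← Real.exp_add]; congr 1; ring
  calc 2 * (1 / Z * ((finsetB I x).card : ℝ) + E * (1 + Real.log H) +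
        ((finsetB I x).card : ℝ) / (1 / Z * H))
      ≤ 2 * (x * w + E * (3 * l) + x * w) := by linarith
    _ = 4 * (x * w) + 1830 * (2 ^ K * (x * (l ^ 5 * w))) := by rw [hE]; ring
    _ ≤ 2000 * (2 ^ K * (x * (l ^ 5 * w))) := by
        have : 0 ≤ 2 ^ K * (x * (l ^ 5 * w)) := by positivity
        linarith
    _ ≤ 2000 * (2 ^ K * (x * Real.exp (-0.42 * L))) := by gcongr
    _ = _ := by ring

/-! ### From discrepancy to uniform distribution. -/

lemma one_div_sqrt_six_lt : 1 / √6 < 0.42 := by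
  have h : 2.44 < √6 := by
    rw [Real.lt_sqrt (by norm_num)]; norm_num
  rw [div_lt_iff₀ (by linarith)]
  linarith

lemma tendsto_mul_exp_errorExponent {κ : ℝ} (hκ : κ < 1 / √6) :
    Tendsto (fun x : ℝ => x * Real.exp (-κ * errorExponent x)) atTop atTop := by
  have h := tendsto_rpow_atTop (show (0 : ℝ) < 0.58 by norm_num)
  refine tendsto_atTop_mono' _ ?_ h
  filter_upwards [eventually_sqrt_log_le_errorExponent, eventually_gt_atTop 0] with x hL hx
  have h1 := one_div_sqrt_six_lt
  have h2 := errorExponent_nonneg x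
  rw [Real.rpow_def_of_pos hx]
  nth_rewrite 2 [← Real.exp_log hx]
  rw [← Real.exp_add, Real.exp_le_exp]
  have h3 : κ * errorExponent x ≤ 0.42 * errorExponent x := by gcongr; linarith
  have := hL.2.1
  linarith

lemma tendsto_discrepancyB_div_countB {α : ℝ} (hα : Irrational α)
    (hfin : irrationalityMeasure α < ⊤) {K : ℕ} {I : ℕ → Set ℝ}
    (hI : ∀ n : ℕ, 1 ≤ n → IsUnionOfIntervals K (I n)) {κ : ℝ} (hκ : κ < 1 / √6)
    (hB : (fun x : ℝ => x * Real.exp (-κ * errorExponent x)) =O[atTop]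
      fun x : ℝ => (countB I x : ℝ)) :
    Tendsto (fun x => discrepancyB I α x / countB I x) atTop (𝓝 0) := by
  have h1 : (fun x => discrepancyB I α x) =O[atTop]
      fun x : ℝ => x * Real.exp (-0.42 * errorExponent x) := by
    apply IsBigO.of_bound (2000 * 2 ^ K)
    filter_upwards [eventually_discrepancyB_le hα hfin, eventually_ge_atTop 0] with x hx hx0
    have h0 : 0 ≤ discrepancyB I α x := Real.iSup_nonneg fun y => abs_nonneg _
    rw [Real.norm_of_nonneg h0, Real.norm_of_nonneg (by positivity)]
    exact hx K I hI
  have h2 : (fun x : ℝ => x * Real.exp (-0.42 * errorExponent x)) =o[atTop]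
      fun x : ℝ => x * Real.exp (-κ * errorExponent x) := by
    refine (isBigO_refl (fun x : ℝ => x) atTop).mul_isLittleO ?_
    rw [Real.isLittleO_exp_comp_exp_comp]
    have h3 : Tendsto (fun x => (0.42 - κ) * errorExponent x) atTop atTop :=
      tendsto_errorExponent.const_mul_atTop (by linarith [one_div_sqrt_six_lt])
    refine h3.congr fun x => ?_
    ring
  exact ((h1.trans_isLittleO h2).trans_isBigO hB).tendsto_div_nhds_zero

lemma infinite_setB_of_isBigO {I : ℕ → Set ℝ} {κ : ℝ} (hκ : κ < 1 / √6)
    (hB : (fun x : ℝ => x * Real.exp (-κ * errorExponent x)) =O[atTop]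
      fun x : ℝ => (countB I x : ℝ)) : (setB I).Infinite := by
  intro hf
  have h1 : (fun x : ℝ => (countB I x : ℝ)) =O[atTop] fun _ => (1 : ℝ) := by
    apply IsBigO.of_bound ((setB I).ncard : ℝ)
    refine Eventually.of_forall fun x => ?_
    rw [norm_one, mul_one, Real.norm_of_nonneg (Nat.cast_nonneg _)]
    exact Nat.cast_le.mpr (Set.ncard_le_ncard (fun n hn => hn.1) hf)
  have h2 := (hB.trans h1).isBoundedUnder_le
  exact not_isBoundedUnder_of_tendsto_atTop
    (tendsto_norm_atTop_atTop.comp (tendsto_mul_exp_errorExponent hκ)) h2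

/-- Two integers with the same fractional part would make a nonzero integer multiple of `α` an
integer. This controls the endpoint `c` when a closed interval is written as a difference of two
initial ones. -/
lemma card_filter_fract_eq_le_one {α : ℝ} (hα : Irrational α) (F : Finset ℕ) (c : ℝ) :
    (F.filter fun n : ℕ => Int.fract (α * n) = c).card ≤ 1 := by
  rw [Finset.card_le_one]
  intro a ha b hb
  have h1 := (Finset.mem_filter.mp ha).2.trans (Finset.mem_filter.mp hb).2.symm
  by_contra hne
  obtain ⟨z, hz⟩ := Int.fract_eq_fract.mp h1
  have h2 : ((a : ℤ) - b) ≠ 0 := by omega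
  have h3 : α * (((a : ℤ) - b : ℤ) : ℝ) = z := by push_cast; linarith
  exact (hα.mul_intCast h2).ne_int z h3

lemma abs_card_fract_mem_Icc_sub_le {α : ℝ} (hα : Irrational α) (I : ℕ → Set ℝ) {x : ℝ}
    (hx : 0 ≤ x) {c d : ℝ} (hc : 0 ≤ c) (hcd : c < d) (hd : d ≤ 1) :
    |(((finsetB I x).filter fun n : ℕ => Int.fract (α * n) ∈ Set.Icc c d).card : ℝ) -
      (d - c) * countB I x| ≤ 2 * discrepancyB I α x + 1 := by
  set F := finsetB I x with hF
  have hdisc {y : ℝ} (hy0 : 0 ≤ y) (hy1 : y ≤ 1) :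
      |((F.filter fun n : ℕ => Int.fract (α * n) ≤ y).card : ℝ) - y * countB I x| ≤
        discrepancyB I α x := by
    rw [hF, ← countBFract_eq I α hx]
    exact le_ciSup (bddAbove_discrepancyB I α x) ⟨y, hy0, hy1⟩
  have h1 : ((F.filter fun n : ℕ => Int.fract (α * n) ∈ Set.Icc c d).card : ℝ) +
      (F.filter fun n : ℕ => Int.fract (α * n) ≤ c).card =
      (F.filter fun n : ℕ => Int.fract (α * n) ≤ d).card +
      (F.filter fun n : ℕ => Int.fract (α * n) = c).card := by
    rw [← Finset.sum_boole, ← Finset.sum_boole, ← Finset.sum_boole, ← Finset.sum_boole,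
      ← Finset.sum_add_distrib, ← Finset.sum_add_distrib]
    refine Finset.sum_congr rfl fun n _ => ?_
    simp only [Set.mem_Icc]
    rcases lt_trichotomy (Int.fract (α * n)) c with h | h | h
    · rw [if_neg (by rintro ⟨h1, _⟩; linarith), if_pos h.le, if_pos (by linarith), if_neg h.ne]
      norm_num
    · rw [if_pos ⟨h.ge, by linarith⟩, if_pos h.le, if_pos (by linarith), if_pos h]
    · rw [if_neg (not_le.mpr h), if_neg h.ne']
      congr 1
      exact if_congr ⟨fun h2 => h2.2, fun h2 => ⟨h.le, h2⟩⟩ rfl rfl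
  have h2 : ((F.filter fun n : ℕ => Int.fract (α * n) = c).card : ℝ) ≤ 1 := by
    exact_mod_cast card_filter_fract_eq_le_one hα F c
  have h3 : (0 : ℝ) ≤ (F.filter fun n : ℕ => Int.fract (α * n) = c).card := Nat.cast_nonneg _
  have h4 := abs_le.mp (hdisc hc (by linarith))
  have h5 := abs_le.mp (hdisc (by linarith) hd)
  rw [abs_le]
  constructor <;> linarith [h4.1, h4.2, h5.1, h5.2]

lemma finsetB_nth_eq {I : ℕ → Set ℝ} (hinf : (setB I).Infinite) (N : ℕ) :
    finsetB I (Nat.nth (· ∈ setB I) N) =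
      (Finset.range (N + 1)).image (Nat.nth (· ∈ setB I)) := by
  have hmono := Nat.nth_strictMono (p := (· ∈ setB I)) hinf
  ext n
  rw [mem_finsetB (Nat.cast_nonneg _), Finset.mem_image, Nat.cast_le]
  constructor
  · rintro ⟨h1, h2⟩
    have h3 : n ∈ Set.range (Nat.nth (· ∈ setB I)) := by
      rw [Nat.range_nth_of_infinite (p := (· ∈ setB I)) hinf]; exact h1
    obtain ⟨k, rfl⟩ := h3
    exact ⟨k, Finset.mem_range.mpr (Nat.lt_succ_of_le (hmono.le_iff_le.mp h2)), rfl⟩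
  · rintro ⟨k, hk, rfl⟩
    exact ⟨Nat.nth_mem_of_infinite (p := (· ∈ setB I)) hinf k,
      hmono.monotone (Nat.lt_succ_iff.mp (Finset.mem_range.mp hk))⟩

lemma uniformlyDistributed_of_tendsto {α : ℝ} (hα : Irrational α) {I : ℕ → Set ℝ}
    (hinf : (setB I).Infinite)
    (hlim : Tendsto (fun x => discrepancyB I α x / countB I x) atTop (𝓝 0)) :
    UniformlyDistributedModOne fun k : ℕ => α * (Nat.nth (· ∈ setB I) k : ℝ) := by
  intro c d hc hcd hd
  set ν := Nat.nth (· ∈ setB I) with hν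
  have hmono : StrictMono ν := Nat.nth_strictMono hinf
  have hcount (N : ℕ) : countB I (ν N) = N + 1 := by
    rw [countB_eq I (Nat.cast_nonneg _), finsetB_nth_eq hinf,
      Finset.card_image_of_injective _ hmono.injective, Finset.card_range]
  have hncard (N : ℕ) : {n : ℕ | n < N + 1 ∧ Int.fract (α * (ν n : ℝ)) ∈ Set.Icc c d}.ncard =
      ((finsetB I (ν N)).filter fun n : ℕ => Int.fract (α * n) ∈ Set.Icc c d).card := by
    rw [finsetB_nth_eq hinf, Finset.filter_image,
      Finset.card_image_of_injective _ hmono.injective, ← Set.ncard_coe_finset]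
    congr 1
    ext n
    simp [hν]
  have htend : Tendsto (fun N : ℕ => (ν N : ℝ)) atTop atTop :=
    tendsto_natCast_atTop_atTop.comp hmono.tendsto_atTop
  -- Enumeration starts at index 0, so `x = ν N` captures exactly the first `N + 1` terms; hence the
  -- shift.
  rw [← tendsto_add_atTop_iff_nat 1, tendsto_iff_norm_sub_tendsto_zero]
  have hbound : Tendsto (fun N : ℕ => 2 * (discrepancyB I α (ν N) / countB I (ν N)) +
      1 / ((N : ℝ) + 1)) atTop (𝓝 0) := by
    have := ((hlim.comp htend).const_mul 2).add tendsto_one_div_add_atTop_nhds_zero_nat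
    simpa using this
  refine squeeze_zero (fun _ => norm_nonneg _) (fun N => ?_) hbound
  have hN : (0 : ℝ) < (N : ℝ) + 1 := by positivity
  have h1 := abs_card_fract_mem_Icc_sub_le hα I (x := ν N) (Nat.cast_nonneg _) hc hcd hd
  rw [hncard, Real.norm_eq_abs]
  rw [hcount] at h1 ⊢
  push_cast at h1 ⊢
  set A := (((finsetB I (ν N)).filter fun n : ℕ => Int.fract (α * n) ∈ Set.Icc c d).card : ℝ)
  have h2 : A / ((N : ℝ) + 1) - (d - c) = (A - (d - c) * (N + 1)) / (N + 1) := by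
    field_simp
  rw [h2, abs_div, abs_of_pos hN, div_le_iff₀ hN]
  refine h1.trans (le_of_eq ?_)
  field_simp

theorem theorem4 :
    (∃ x₀ : ℝ → ℝ, ∀ κ : ℝ, κ < 1 / √6 → ∀ K : ℕ, ∃ C : ℝ,
      ∀ α : ℝ, Irrational α → irrationalityMeasure α < ⊤ →
      ∀ I : ℕ → Set ℝ, (∀ n : ℕ, 1 ≤ n → IsUnionOfIntervals K (I n)) →
      ∀ x : ℝ, x₀ α ≤ x →
        discrepancyB I α x ≤
          C * (x / Real.exp (κ * √(Real.log x * Real.log (Real.log x))))) ∧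
    (∀ α : ℝ, Irrational α → irrationalityMeasure α < ⊤ →
      ∀ (K : ℕ) (I : ℕ → Set ℝ), (∀ n : ℕ, 1 ≤ n → IsUnionOfIntervals K (I n)) →
      (∃ κ : ℝ, κ < 1 / √6 ∧
        (fun x : ℝ => x * Real.exp (-κ * √(Real.log x * Real.log (Real.log x))))
          =O[atTop] fun x : ℝ => (countB I x : ℝ)) →
      (setB I).Infinite ∧
        UniformlyDistributedModOne fun k : ℕ => α * (Nat.nth (· ∈ setB I) k : ℝ)) := by

  constructor
  -- The exponent `0.42` serves every admissible `κ`, so the threshold depends on `α` alone;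
  -- nonnegativity of `x` is included for the final comparison of exponentials.
  · have hex : ∀ α : ℝ, ∃ x₀ : ℝ, Irrational α → irrationalityMeasure α < ⊤ →
        ∀ x : ℝ, x₀ ≤ x → 0 ≤ x ∧ ∀ (K : ℕ) (I : ℕ → Set ℝ),
          (∀ n : ℕ, 1 ≤ n → IsUnionOfIntervals K (I n)) →
            discrepancyB I α x ≤ 2000 * 2 ^ K * (x * Real.exp (-0.42 * errorExponent x)) := by
      intro α
      by_cases h : Irrational α ∧ irrationalityMeasure α < ⊤
      · obtain ⟨x₀, hx₀⟩ := eventually_atTop.mp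
          ((eventually_ge_atTop 0).and (eventually_discrepancyB_le h.1 h.2))
        exact ⟨x₀, fun _ _ => hx₀⟩
      · exact ⟨0, fun h1 h2 => absurd ⟨h1, h2⟩ h⟩
    choose x₀ hx₀ using hex
    refine ⟨x₀, fun κ hκ K => ⟨2000 * 2 ^ K, fun α hα hfin I hI x hx => ?_⟩⟩
    obtain ⟨hx0, h⟩ := hx₀ α hα hfin x hx
    refine (h K I hI).trans ?_
    rw [div_eq_mul_inv, ← Real.exp_neg]
    gcongr
    change -0.42 * errorExponent x ≤ -(κ * errorExponent x)
    have h1 : κ * errorExponent x ≤ 0.42 * errorExponent x :=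
      mul_le_mul_of_nonneg_right (hκ.trans one_div_sqrt_six_lt).le (errorExponent_nonneg x)
    linarith
  · rintro α hα hfin K I hI ⟨κ, hκ, hB⟩
    have hinf := infinite_setB_of_isBigO hκ hB
    exact ⟨hinf, uniformlyDistributed_of_tendsto hα hinf
      (tendsto_discrepancyB_div_countB hα hfin hI hκ hB)⟩
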